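/- Let $n\in\mathbb N$ and let $p,\lambda\in\mathbb R$ satisfy $1<p<\lambda<n$; put $p_1:=\lambda p/(\lambda-p)$ and let $q>p_1$ be a real number. Write $B_1$ for the open unit ball of $\mathbb R^n$ centred at $0$. For a weakly differentiable $u:\mathbb R^n\to\mathbb R$ put $$\|\nabla u\|_{M^{p,\lambda}(B_1)}^p:=\sup_{r>0,\;y\in\overline{B_1}} r^{\lambda-n}\int_{B_1\cap B_r(y)}|\nabla u(x)|^p\,dx,\qquad |||\nabla u|||_{p,\lambda;B_1}^p:=\sup_{y\in\overline{B_1}}\int_{B_1}|\nabla u(x)|^p\,|x-y|^{\lambda-n}\,dx .$$ Call $u:\mathbb R^n\to\mathbb R$ a *counterexample* if $u=0$ on $\mathbb R^n\setminus B_1$; $u$ is locally integrable, differentiable almost everywhere, and its pointwise gradient $\nabla u$ is locally integrable and is also its distributional gradient on $\mathbb R^n$; and $$\|u\|_{L^q(B_1)}=\infty,\qquad |||\nabla u|||_{p,\lambda;B_1}<\infty,\qquad \|\nabla u\|_{M^{p,\lambda}(B_1)}<\infty .$$ A *cutoff* is a Lipschitz function $\xi:[0,\infty)\to[0,1]$ with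 $\xi=1$ on $[0,1/2)$ and $\xi=0$ on $[\sqrt3/3,\infty)$. For $\gamma\in(0,1)$ the generalized Cantor set $C_\gamma\subset[-\tfrac12,\tfrac12]$ is obtained from $[-\tfrac12,\tfrac12]$ by removing, at each step $j=1,2,\dots$, from each remaining segment (of length $l_{j-1}=((1-\gamma)/2)^{j-1}$) the central open interval of length $\gamma\, l_{j-1}$. For an integer $k$ with $2\le k\le n$ and $k-1<\lambda<k$ let $$\mathcal C_{k,\lambda}:=\{0\}\times C_\gamma\subset\mathbb R^{k-1}\times[-\tfrac12,\tfrac12],\qquad \gamma=1-2^{\,1-\frac1{k-\lambda}} .$$ Functions given below by a formula that is undefined on a null set are given the value $0$ there. Then: 1. There exists a counterexample $u$. 2. If $\lambda$ is an integer, then for every $\alpha$ with $\frac{\lambda}{q}\le\alpha<\frac{\lambda-p}{p}$ and every cutoff $\xi$ the function $u(x)=(|x'|^{-\alpha}-2^\alpha)_+\,\xi(|x''|)$, where $x=(x',x'')\in\mathbb R^\lambda\times\mathbb R^{n-\lambda}$, is a counterexample. 3. If $k-1<\lambda<k$ for an integer $k$ with $2\le k\le n$, then $\mathcal C_{k,\lambda}$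 has Hausdorff dimension $k-\lambda$, and for every $\alpha$ with $\frac{\lambda}{q}\le\alpha<\frac{\lambda-p}{p}$ (and, if $k<n$, every cutoff $\xi$) the function $$u(x)=\begin{cases}\big(\operatorname{dist}(x,\mathcal C_{n,\lambda})^{-\alpha}-4^\alpha\big)_+ & \text{if } k=n,\\[2pt] \big(\operatorname{dist}(x',\mathcal C_{k,\lambda})^{-\alpha}-4^\alpha\big)_+\,\xi(|x''|) & \text{if } k<n,\end{cases}$$ where $x=(x',x'')\in\mathbb R^k\times\mathbb R^{n-k}$, is a counterexample. 4. Consequently the exponent $p_1$ in Adams' embedding cannot be increased: there is no finite constant $C$ such that $\|u\|_{L^q(B_1)}\le C\,\|\nabla u\|_{M^{p,\lambda}(B_1)}$ for all Lipschitz functions $u:\mathbb R^n\to\mathbb R$ vanishing outside $B_1$, and no finite $C$ such that $\|u\|_{L^q(B_1)}\le C\,|||\nabla u|||_{p,\lambda;B_1}$ for all such $u$. -/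

import Mathlib

open MeasureTheory Metric Set
open scoped ENNReal NNReal ContDiff

noncomputable section

/-- The Morrey norm of a vector field `F` on `Ω`:
`‖F‖_{M^{p,λ}(Ω)} = (sup_{r > 0, y ∈ closure Ω} r^{λ-n} ∫_{Ω ∩ B_r(y)} |F|^p dx)^{1/p}`,
with values in `[0, ∞]`. -/
def morreyNorm {n : ℕ} (p lam : ℝ) (Ω : Set (EuclideanSpace ℝ (Fin n)))
    (F : EuclideanSpace ℝ (Fin n) → EuclideanSpace ℝ (Fin n)) : ℝ≥0∞ :=
  (⨆ (r : ℝ) (_ : 0 < r) (y ∈ closure Ω),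
    ENNReal.ofReal (r ^ (lam - n)) * ∫⁻ x in Ω ∩ ball y r, ‖F x‖ₑ ^ p) ^ (1 / p)

/-- The triple norm of a vector field `F` on `Ω`:
`(sup_{y ∈ closure Ω} ∫_Ω |F(x)|^p |x-y|^{λ-n} dx)^{1/p}`, with values in `[0, ∞]`. -/
def tripleNorm {n : ℕ} (p lam : ℝ) (Ω : Set (EuclideanSpace ℝ (Fin n)))
    (F : EuclideanSpace ℝ (Fin n) → EuclideanSpace ℝ (Fin n)) : ℝ≥0∞ :=
  (⨆ y ∈ closure Ω, ∫⁻ x in Ω, ‖F x‖ₑ ^ p * ‖x - y‖ₑ ^ (lam - n)) ^ (1 / p)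

/-- `F` is the weak (distributional) gradient of `u` on the whole space `ℝⁿ`, both being
locally integrable. -/
def HasWeakGradient {n : ℕ} (u : EuclideanSpace ℝ (Fin n) → ℝ)
    (F : EuclideanSpace ℝ (Fin n) → EuclideanSpace ℝ (Fin n)) : Prop :=
  LocallyIntegrable u ∧ LocallyIntegrable F ∧
    ∀ φ : EuclideanSpace ℝ (Fin n) → ℝ, ContDiff ℝ ∞ φ → HasCompactSupport φ →
      ∀ i : Fin n,
        ∫ x, u x * fderiv ℝ φ x (EuclideanSpace.single i 1) = -∫ x, F x i * φ x

/-- The function `u` violates the embeddings of the Morrey norm and of the triple norm of the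
gradient on the unit ball `B₁` into `L^q(B₁)`. The pointwise gradient exists almost everywhere
and is also the distributional gradient on `ℝⁿ`, so there is no ambiguity in the meaning
of `∇u`. -/
structure IsCounterexample {n : ℕ} (p lam q : ℝ) (u : EuclideanSpace ℝ (Fin n) → ℝ) : Prop where
  eq_zero : ∀ x ∉ ball (0 : EuclideanSpace ℝ (Fin n)) 1, u x = 0
  ae_differentiable : ∀ᵐ x, DifferentiableAt ℝ u x
  weak_gradient : HasWeakGradient u (gradient u)
  eLpNorm_eq_top : eLpNorm u (ENNReal.ofReal q) (volume.restrict (ball 0 1)) = ⊤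
  tripleNorm_lt_top : tripleNorm p lam (ball 0 1) (gradient u) < ⊤
  morreyNorm_lt_top : morreyNorm p lam (ball 0 1) (gradient u) < ⊤

/-- A cutoff function `ξ : [0, ∞) → [0, 1]` with `ξ = 1` on `[0, 1/2)` and `ξ = 0` on
`[√3/3, ∞)`. The regularity required is Lipschitz continuity, which every `C¹` function with these
properties has. Only the values of `ξ` on `[0, ∞)` matter. -/
structure IsCutoff (ξ : ℝ → ℝ) : Prop where
  lipschitz : ∃ K : ℝ≥0, LipschitzOnWith K ξ (Ici 0)
  mem_Icc : ∀ t, 0 ≤ t → ξ t ∈ Icc (0 : ℝ) 1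
  eq_one : ∀ t, 0 ≤ t → t < 1 / 2 → ξ t = 1
  eq_zero : ∀ t, √3 / 3 ≤ t → ξ t = 0

/-- The first `k` coordinates `x'` of `x = (x', x'') ∈ ℝᵏ × ℝⁿ⁻ᵏ`. -/
def headPart {n k : ℕ} (h : k ≤ n) (x : EuclideanSpace ℝ (Fin n)) : EuclideanSpace ℝ (Fin k) :=
  WithLp.toLp 2 fun i => x (Fin.castLE h i)

/-- The last `n - k` coordinates `x''` of `x = (x', x'') ∈ ℝᵏ × ℝⁿ⁻ᵏ`. -/
def tailPart {n k : ℕ} (h : k ≤ n) (x : EuclideanSpace ℝ (Fin n)) :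
    EuclideanSpace ℝ (Fin (n - k)) :=
  WithLp.toLp 2 fun i => x ⟨k + i, by omega⟩

/-- The length `((1-γ)/2)^j` of the segments remaining after `j` steps of the construction of the
generalized Cantor set. -/
def cantorLength (γ : ℝ) (j : ℕ) : ℝ := ((1 - γ) / 2) ^ j

/-- The midpoints of the `2^j` segments remaining after `j` steps of the construction of the
generalized Cantor set. At the start there is the segment `[-1/2, 1/2]`. When the central interval
of length `γ l` is removed from a segment of length `l` with midpoint `c`, the midpoints of the
two pieces that are left are `c ± (1+γ) l / 4`. -/
def cantorMidpoints (γ : ℝ) : ℕ → Set ℝ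
  | 0 => {0}
  | j + 1 => {t | ∃ c ∈ cantorMidpoints γ j,
      t = c - (1 + γ) / 4 * cantorLength γ j ∨ t = c + (1 + γ) / 4 * cantorLength γ j}

/-- The generalized Cantor set `C_γ`: from `[-1/2, 1/2]` one removes, at each step, the central
open interval of length `γ l` of each remaining segment, `l` being the length of the segment. -/
def genCantorSet (γ : ℝ) : Set ℝ :=
  Icc (-1 / 2) (1 / 2) \
    ⋃ (j : ℕ) (c ∈ cantorMidpoints γ j),
      Ioo (c - γ * cantorLength γ j / 2) (c + γ * cantorLength γ j / 2)

/-- The set `{0} × C_γ ⊆ ℝᵏ⁻¹ × [-1/2, 1/2]` with `γ = 1 - 2^{1 - 1/(k-λ)}`. -/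
def singularSet (k : ℕ) (lam : ℝ) : Set (EuclideanSpace ℝ (Fin k)) :=
  {z | ∀ i : Fin k, ((i : ℕ) + 1 < k → z i = 0) ∧
    ((i : ℕ) + 1 = k → z i ∈ genCantorSet (1 - 2 ^ (1 - 1 / ((k : ℝ) - lam))))}

/-- `(|x'|^{-α} - 2^α)₊ ξ(|x''|)` with `x = (x', x'') ∈ ℝᵏ × ℝⁿ⁻ᵏ`.
On the null set `x' = 0`, where the formula has no meaning, the value is `0`. -/
def counterexampleInt {n k : ℕ} (h : k ≤ n) (α : ℝ) (ξ : ℝ → ℝ)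
    (x : EuclideanSpace ℝ (Fin n)) : ℝ :=
  max (‖headPart h x‖ ^ (-α) - 2 ^ α) 0 * ξ ‖tailPart h x‖

/-- `(dist(z, {0} × C_γ)^{-α} - 4^α)₊` for `z ∈ ℝᵏ`.
On the null set `{0} × C_γ`, where the formula has no meaning, the value is `0`. -/
def distCounterexample {k : ℕ} (lam α : ℝ) (z : EuclideanSpace ℝ (Fin k)) : ℝ :=
  max (infDist z (singularSet k lam) ^ (-α) - 4 ^ α) 0

/-- `(dist(x', {0} × C_γ)^{-α} - 4^α)₊ ξ(|x''|)` with `x = (x', x'') ∈ ℝᵏ × ℝⁿ⁻ᵏ`. -/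
def distCounterexampleCutoff {n k : ℕ} (h : k ≤ n) (lam α : ℝ) (ξ : ℝ → ℝ)
    (x : EuclideanSpace ℝ (Fin n)) : ℝ :=
  distCounterexample lam α (headPart h x) * ξ ‖tailPart h x‖

end

/-! Write λ = k − s with k = ⌈λ⌉ and take a self-similar set E ⊂ ℝᵏ of dimension s: the origin if λ
is an integer, a Cantor set on the last axis otherwise. With d = dist(x', E), the function u behaves
like d^(-α) near E × ℝⁿ⁻ᵏ, a set of codimension λ. The ρ-neighbourhood of E has volume of order ρ^λ,
so d^(-b) is locally integrable precisely for b < λ. Since |u|^q is comparable to d^(-αq) near E and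
|∇u|^p is at most a constant times d^(-(α+1)p), one needs αq ≥ λ and (α+1)p < λ, that is, λ/q ≤ α <
(λ-p)/p. This range is nonempty exactly because q > p₁.

For the triple norm, d^(-(α+1)p) has to be integrated against |x-y|^(λ-n) uniformly in y. This rests
on a local volume count: the l^i-neighbourhood of E fills at most a constant times l^(sj + (k-s)
max(i,j)) of any ball of radius l^j (`exists_measure_near_inter_ball_le`). Decomposing both singular
factors into scales turns the integral into a double geometric series (`exists_lintegral_le`). The
Morrey norm is dominated by the triple norm. Divergence of the L^q norm comes from disjoint layers
around E that all contribute the same amount (`IsSelfSimilar.lintegral_eq_top`).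

Replacing d by max(d, δ) gives Lipschitz functions with gradient bounds uniform in δ. Letting δ → 0,
dominated convergence shows that the pointwise gradient of u is its weak gradient, and Fatou's lemma
shows that the L^q norms of the truncations are unbounded, which refutes both embeddings on
Lipschitz functions.

The dimension of the Cantor set is bounded above by counting pieces, and below by a Hölder map onto
a set containing [0,1] that reads the address of a point as a binary expansion. -/

/-- `E` is a nonempty subset of the ball of radius `1/2` which is the union of its images under the
similarities `x ↦ l • x + v i`, these images having mutual distance at least `g`; the number of the
similarities is `l ^ (-s)`, that is, `s` is the similarity dimension of `E`. -/
structure IsSelfSimilar {X ι : Type*} [NormedAddCommGroup X] [NormedSpace ℝ X] [Fintype ι]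
    (l s g : ℝ) (v : ι → X) (E : Set X) : Prop where
  nonempty : E.Nonempty
  subset : E ⊆ closedBall 0 (1 / 2)
  pos : 0 < l
  lt_one : l < 1
  dim_nonneg : 0 ≤ s
  card_mul : (Fintype.card ι : ℝ) * l ^ s = 1
  gap_pos : 0 < g
  maps : ∀ i, ∀ x ∈ E, l • x + v i ∈ E
  cover : ∀ x ∈ E, ∃ i, ∃ y ∈ E, x = l • y + v i
  gap : ∀ i j, i ≠ j → ∀ x ∈ E, ∀ y ∈ E, g ≤ dist (l • x + v i) (l • y + v j)

/-! ### Neighbourhoods of a self-similar set: scaling, volume and the Morrey-type integral -/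

namespace IsSelfSimilar

variable {X ι : Type*} [NormedAddCommGroup X] [NormedSpace ℝ X] [Fintype ι]
  {l s g : ℝ} {v : ι → X} {E : Set X}

theorem dist_map (h : IsSelfSimilar l s g v E) (i : ι) (x y : X) :
    dist (l • x + v i) (l • y + v i) = l * dist x y := by
  rw [dist_add_right, dist_smul₀, Real.norm_of_nonneg h.pos.le]

theorem map_inv (h : IsSelfSimilar l s g v E) (i : ι) (x : X) :
    l • (l⁻¹ • (x - v i)) + v i = x := by
  rw [smul_inv_smul₀ h.pos.ne', sub_add_cancel]

theorem exists_dist_lt (h : IsSelfSimilar l s g v E) {a : ℝ} {x : X}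
    (hx : infDist x E < l * a) :
    ∃ i, ∃ e ∈ E, dist x (l • e + v i) < l * a ∧ dist (l⁻¹ • (x - v i)) e < a := by
  obtain ⟨e, he, hd⟩ := (infDist_lt_iff h.nonempty).1 hx
  obtain ⟨i, y, hy, rfl⟩ := h.cover e he
  refine ⟨i, y, hy, hd, ?_⟩
  have := h.dist_map i (l⁻¹ • (x - v i)) y
  rw [h.map_inv] at this
  rw [this] at hd
  exact lt_of_mul_lt_mul_left hd h.pos.le

theorem near_subset (h : IsSelfSimilar l s g v E) (a : ℝ) :
    {x | infDist x E < l * a} ⊆ ⋃ i, (fun x => l • x + v i) '' {x | infDist x E < a} := by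
  intro x hx
  obtain ⟨i, e, he, -, h2⟩ := h.exists_dist_lt hx
  refine mem_iUnion.2 ⟨i, l⁻¹ • (x - v i), ?_, h.map_inv i x⟩
  exact (infDist_lt_iff h.nonempty).2 ⟨e, he, h2⟩

theorem infDist_map_le (h : IsSelfSimilar l s g v E) (i : ι) (x : X) :
    infDist (l • x + v i) E ≤ l * infDist x E := by
  refine le_of_forall_gt fun c hc => ?_
  have : infDist x E < c / l := by rwa [lt_div_iff₀' h.pos]
  obtain ⟨e, he, hd⟩ := (infDist_lt_iff h.nonempty).1 this
  refine (infDist_lt_iff h.nonempty).2 ⟨_, h.maps i e he, ?_⟩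
  rwa [h.dist_map, ← lt_div_iff₀' h.pos]

/-- A point within `a` of `E` is sent within `l * a` of the `i`-th piece; since `2 * (l * a) ≤ g`,
no other piece can be nearer, so the distance scales exactly. -/
theorem infDist_map (h : IsSelfSimilar l s g v E) {a : ℝ} (ha : 2 * (l * a) ≤ g) (i : ι) {x : X}
    (hx : infDist x E < a) : infDist (l • x + v i) E = l * infDist x E := by
  refine le_antisymm (h.infDist_map_le i x) ((le_infDist h.nonempty).2 fun e he => ?_)
  obtain ⟨j, y, hy, rfl⟩ := h.cover e he
  have hl := h.pos
  by_cases hij : i = j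
  · subst hij
    rw [h.dist_map]
    exact mul_le_mul_of_nonneg_left (infDist_le_dist_of_mem hy) hl.le
  · obtain ⟨z, hz, hd⟩ := (infDist_lt_iff h.nonempty).1 hx
    have h1 := h.gap i j hij z hz y hy
    have h2 := dist_triangle_left (l • z + v i) (l • y + v j) (l • x + v i)
    rw [h.dist_map] at h2
    have h3 : l * dist x z < l * a := mul_lt_mul_of_pos_left hd hl
    have h4 : l * infDist x E < l * a := mul_lt_mul_of_pos_left hx hl
    linarith

theorem disjoint_images (h : IsSelfSimilar l s g v E) {a : ℝ} (ha : 2 * (l * a) ≤ g) {i j : ι}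
    (hij : i ≠ j) {S : Set X} (hS : S ⊆ {x | infDist x E < a}) :
    Disjoint ((fun x => l • x + v i) '' S) ((fun x => l • x + v j) '' S) := by
  rw [Set.disjoint_left]
  rintro _ ⟨x, hx, rfl⟩ ⟨y, hy, hxy⟩
  obtain ⟨e, he, h1⟩ := (infDist_lt_iff h.nonempty).1 (hS hx)
  obtain ⟨f, hf, h2⟩ := (infDist_lt_iff h.nonempty).1 (hS hy)
  have h3 := h.gap i j hij e he f hf
  have h4 := dist_triangle_left (l • e + v i) (l • f + v j) (l • x + v i)
  simp only at hxy
  rw [h.dist_map, ← hxy, h.dist_map] at h4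
  have h5 := mul_lt_mul_of_pos_left h1 h.pos
  have h6 := mul_lt_mul_of_pos_left h2 h.pos
  linarith

/-- Two points of the intersection that are close to different pieces would bring these pieces
closer than `2 * (l * (a + b)) ≤ g`. So only one piece is seen, and the picture there is a scaled
copy of the one a generation earlier. -/
theorem near_inter_ball_subset (h : IsSelfSimilar l s g v E) {a b : ℝ}
    (hab : 2 * (l * (a + b)) ≤ g) (y : X) :
    {x | infDist x E < l * a} ∩ ball y (l * b) = ∅ ∨ ∃ i,
      {x | infDist x E < l * a} ∩ ball y (l * b) ⊆
        (fun x => l • x + v i) '' ({x | infDist x E < a} ∩ ball (l⁻¹ • (y - v i)) b) := by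
  rcases eq_empty_or_nonempty ({x | infDist x E < l * a} ∩ ball y (l * b)) with h0 | ⟨x₀, hx₀, hy₀⟩
  · exact Or.inl h0
  · obtain ⟨i, e, he, h1, -⟩ := h.exists_dist_lt hx₀
    refine Or.inr ⟨i, ?_⟩
    rintro x ⟨hx, hxy⟩
    obtain ⟨j, f, hf, h2, h3⟩ := h.exists_dist_lt hx
    have hij : i = j := by
      by_contra hij
      have h4 := h.gap i j hij e he f hf
      have h5 := dist_triangle4 (l • e + v i) x₀ x (l • f + v j)
      have h6 := dist_triangle_right x₀ x y
      rw [dist_comm _ x₀] at h5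
      rw [mem_ball] at hy₀ hxy
      linarith
    subst hij
    refine ⟨l⁻¹ • (x - v i), ⟨(infDist_lt_iff h.nonempty).2 ⟨f, hf, h3⟩, ?_⟩, h.map_inv i x⟩
    have h7 := h.dist_map i (l⁻¹ • (x - v i)) (l⁻¹ • (y - v i))
    rw [h.map_inv, h.map_inv] at h7
    rw [mem_ball, h7] at hxy
    exact lt_of_mul_lt_mul_left hxy h.pos.le

theorem card_mul_ennreal (h : IsSelfSimilar l s g v E) :
    (Fintype.card ι : ℝ≥0∞) * ENNReal.ofReal l ^ s = 1 := by
  rw [ENNReal.ofReal_rpow_of_pos h.pos, ← ENNReal.ofReal_natCast, ← ENNReal.ofReal_mul (by simp),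
    h.card_mul, ENNReal.ofReal_one]

theorem ofReal_ne_zero (h : IsSelfSimilar l s g v E) : ENNReal.ofReal l ≠ 0 := by
  simpa using h.pos

theorem ofReal_rpow_add (h : IsSelfSimilar l s g v E) (a b : ℝ) :
    ENNReal.ofReal l ^ (a + b) = ENNReal.ofReal l ^ a * ENNReal.ofReal l ^ b :=
  ENNReal.rpow_add _ _ h.ofReal_ne_zero ENNReal.ofReal_ne_top

theorem ofReal_rpow_le (h : IsSelfSimilar l s g v E) {a b : ℝ} (hab : b ≤ a) :
    ENNReal.ofReal l ^ a ≤ ENNReal.ofReal l ^ b :=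
  ENNReal.rpow_le_rpow_of_exponent_ge (by simpa using h.lt_one.le) hab

theorem card_mul_rpow (h : IsSelfSimilar l s g v E) (a : ℝ) :
    (Fintype.card ι : ℝ≥0∞) * ENNReal.ofReal l ^ a = ENNReal.ofReal l ^ (a - s) := by
  have : a = s + (a - s) := by ring
  conv_lhs => rw [this]
  rw [h.ofReal_rpow_add, ← mul_assoc, h.card_mul_ennreal, one_mul]

theorem ofReal_rpow_mul_natCast (c : ℝ) (m : ℕ) :
    ENNReal.ofReal l ^ (c * m) = (ENNReal.ofReal l ^ c) ^ m := by
  rw [ENNReal.rpow_mul, ENNReal.rpow_natCast]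

variable [MeasurableSpace X] [BorelSpace X] [FiniteDimensional ℝ X] (μ : Measure X)
  [μ.IsAddHaarMeasure]

open scoped Pointwise in
theorem measure_map (h : IsSelfSimilar l s g v E) (i : ι) (S : Set X) :
    μ ((fun x => l • x + v i) '' S) = ENNReal.ofReal l ^ (Module.finrank ℝ X : ℝ) * μ S := by
  have : (fun x => l • x + v i) '' S = (fun x => x + v i) '' (l • S) := by
    rw [← image_smul, image_image]
  rw [this, image_add_right, measure_preimage_add_right,
    Measure.addHaar_smul_of_nonneg _ h.pos.le, ENNReal.ofReal_pow h.pos.le, ENNReal.rpow_natCast]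

/-- The smaller neighbourhood is covered by `l ^ (-s)` copies of the larger one, each scaled by `l`
in every direction of the space. -/
theorem measure_near_mul_le (h : IsSelfSimilar l s g v E) (a : ℝ) :
    μ {x | infDist x E < l * a} ≤
      ENNReal.ofReal l ^ ((Module.finrank ℝ X : ℝ) - s) * μ {x | infDist x E < a} := by
  refine (measure_mono (h.near_subset a)).trans ((measure_iUnion_fintype_le _ _).trans ?_)
  simp_rw [h.measure_map μ]
  rw [Finset.sum_const, nsmul_eq_mul, ← mul_assoc, Finset.card_univ, h.card_mul_rpow]

theorem measure_near_le (h : IsSelfSimilar l s g v E) (R : ℝ) (m : ℕ) :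
    μ {x | infDist x E < R * l ^ m} ≤
      ENNReal.ofReal l ^ ((Module.finrank ℝ X - s) * m) * μ {x | infDist x E < R} := by
  rw [ofReal_rpow_mul_natCast]
  induction m with
  | zero => simp
  | succ m ih =>
    have : R * l ^ (m + 1) = l * (R * l ^ m) := by ring
    rw [this, pow_succ', mul_assoc]
    exact (h.measure_near_mul_le μ _).trans (mul_le_mul_right ih _)

theorem measure_near_lt_top (h : IsSelfSimilar l s g v E) (R : ℝ) :
    μ {x | infDist x E < R} < ⊤ := by
  refine (measure_mono (t := ball 0 (1 / 2 + R)) fun x hx => ?_).trans_lt measure_ball_lt_top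
  obtain ⟨e, he, hd⟩ := (infDist_lt_iff h.nonempty).1 hx
  have := h.subset he
  rw [mem_closedBall] at this
  rw [mem_ball]
  linarith [dist_triangle x e 0]

theorem measure_near_inter_ball_mul_le (h : IsSelfSimilar l s g v E) {a b : ℝ} {M : ℝ≥0∞}
    (hab : 2 * (l * (a + b)) ≤ g) (hM : ∀ y, μ ({x | infDist x E < a} ∩ ball y b) ≤ M) (y : X) :
    μ ({x | infDist x E < l * a} ∩ ball y (l * b)) ≤
      ENNReal.ofReal l ^ (Module.finrank ℝ X : ℝ) * M := by
  rcases h.near_inter_ball_subset hab y with h0 | ⟨i, hi⟩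
  · simp [h0]
  · refine (measure_mono hi).trans ?_
    rw [h.measure_map μ]
    exact mul_le_mul_right (hM _) _

/-- A neighbourhood of `E` of size `l ^ i` occupies only a small part of a ball of radius
`l ^ j`. -/
theorem exists_measure_near_inter_ball_le (h : IsSelfSimilar l s g v E)
    {R : ℝ} (hR : 0 < R) :
    ∃ A : ℝ≥0∞, A ≠ ⊤ ∧ ∀ (i j : ℕ) (y : X),
      μ ({x | infDist x E < R * l ^ i} ∩ ball y (R * l ^ j)) ≤
        A * ENNReal.ofReal l ^ (s * j + (Module.finrank ℝ X - s) * (max i j : ℕ)) := by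
  have hl := h.pos
  -- From scale `l ^ N` on, neighbourhoods and balls are too small to meet two pieces.
  obtain ⟨N, hN⟩ : ∃ N : ℕ, 4 * R * l ^ N < g := by
    obtain ⟨N, hN⟩ := exists_pow_lt_of_lt_one (div_pos h.gap_pos (by positivity : 0 < 4 * R))
      h.lt_one
    exact ⟨N, by rwa [lt_div_iff₀' (by positivity)] at hN⟩
  set L := ENNReal.ofReal l
  set D : ℝ := ((Module.finrank ℝ X : ℕ) : ℝ)
  set W := μ {x | infDist x E < R}
  have hW : W ≠ ⊤ := (h.measure_near_lt_top μ R).ne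
  have hL0 : L ≠ 0 := h.ofReal_ne_zero
  have hLt : ∀ c : ℝ, L ^ c ≠ ⊤ := fun c => ENNReal.rpow_ne_top_of_ne_zero hL0 ENNReal.ofReal_ne_top
  set B := μ (ball 0 R)
  have hB : B ≠ ⊤ := measure_ball_lt_top.ne
  -- Descend `m` generations inside a single piece, each costing only the volume factor `l ^ D`, and
  -- then use the global bound at generation `i`.
  have hrec : ∀ m i : ℕ, N ≤ i → ∀ y,
      μ ({x | infDist x E < R * l ^ (i + m)} ∩ ball y (R * l ^ (N + m))) ≤
        L ^ (D * m) * (L ^ ((D - s) * i) * W) := by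
    intro m i hi
    induction m with
    | zero =>
      intro y
      simpa using (measure_mono inter_subset_left).trans (h.measure_near_le μ R i)
    | succ m ih =>
      intro y
      have e1 : R * l ^ (i + (m + 1)) = l * (R * l ^ (i + m)) := by ring
      have e2 : R * l ^ (N + (m + 1)) = l * (R * l ^ (N + m)) := by ring
      rw [e1, e2]
      refine (h.measure_near_inter_ball_mul_le μ ?_ ih y).trans_eq ?_
      · have h1 : l ^ (i + m) ≤ l ^ N := pow_le_pow_of_le_one hl.le h.lt_one.le (by omega)
        have h2 : l ^ (N + m) ≤ l ^ N := pow_le_pow_of_le_one hl.le h.lt_one.le (by omega)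
        have h3 : R * l ^ (i + m) + R * l ^ (N + m) ≤ 2 * R * l ^ N := by nlinarith
        have h4 : l * (R * l ^ (i + m) + R * l ^ (N + m)) ≤
            1 * (R * l ^ (i + m) + R * l ^ (N + m)) :=
          mul_le_mul_of_nonneg_right h.lt_one.le (by positivity)
        linarith
      · rw [← mul_assoc, ← h.ofReal_rpow_add]
        congr 2
        push_cast
        ring
  refine ⟨B + W * L ^ (-(s * N)), by simp [ENNReal.mul_eq_top, hB, hW, hLt], fun i j y => ?_⟩
  rcases lt_or_ge i j with hij | hij
  · rw [max_eq_right hij.le]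
    calc _ ≤ μ (ball y (R * l ^ j)) := measure_mono inter_subset_right
      _ = B * L ^ (D * j) := by
        rw [mul_comm R, Measure.addHaar_ball_mul_of_pos _ _ (by positivity), mul_comm,
          ofReal_rpow_mul_natCast, ENNReal.rpow_natCast, ENNReal.ofReal_pow (by positivity),
          ENNReal.ofReal_pow hl.le, ← pow_mul, ← pow_mul, mul_comm j]
      _ = B * L ^ (s * j + (D - s) * j) := by ring_nf
      _ ≤ _ := by gcongr; exact le_self_add
  · rw [max_eq_left hij]
    have key : μ ({x | infDist x E < R * l ^ i} ∩ ball y (R * l ^ j)) ≤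
        W * L ^ (-(s * N) + (s * j + (D - s) * i)) := by
      rcases le_or_gt N j with hj | hj
      · obtain ⟨m, rfl⟩ := Nat.exists_eq_add_of_le hj
        obtain ⟨i', rfl⟩ : ∃ i', i = i' + m := ⟨i - m, by omega⟩
        refine (hrec m i' (by omega) y).trans_eq ?_
        rw [← mul_assoc, ← h.ofReal_rpow_add, mul_comm]
        congr 2
        push_cast
        ring
      -- For `j < N` the ball is discarded; the factor `L ^ (-(s * N))` in the constant absorbs the
      -- missing `L ^ (s * j)`.
      · refine ((measure_mono inter_subset_left).trans (h.measure_near_le μ R i)).trans ?_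
        rw [mul_comm]
        refine mul_le_mul_right (h.ofReal_rpow_le ?_) _
        have : (j : ℝ) ≤ N := by exact_mod_cast hj.le
        nlinarith [h.dim_nonneg]
    rw [h.ofReal_rpow_add, ← mul_assoc] at key
    exact key.trans (by gcongr; exact le_add_self)

/-- The one scale with `R * l ^ (i + 1) ≤ t < R * l ^ i` already suffices; summing over all `i`
replaces this choice by conditions that can be integrated. At `t = 0` every term is present and the
sum is infinite. -/
theorem rpow_neg_le_tsum (h : IsSelfSimilar l s g v E) {R t b : ℝ} (hb : 0 ≤ b) (ht : 0 ≤ t)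
    (htR : t < R) :
    ENNReal.ofReal t ^ (-b) ≤ ∑' i : ℕ, (if t < R * l ^ i then
      ENNReal.ofReal (R * l) ^ (-b) * ENNReal.ofReal l ^ (-b * i) else 0) := by
  have hl := h.pos
  have hR : 0 < R := ht.trans_lt htR
  have hc : ENNReal.ofReal (R * l) ^ (-b) ≠ 0 := by
    simp [ENNReal.rpow_eq_zero_iff, hb.not_gt]
  rcases ht.eq_or_lt with rfl | ht
  · refine le_top.trans ((ENNReal.tsum_const_eq_top_of_ne_zero (α := ℕ) hc).symm.le.trans
      (ENNReal.tsum_le_tsum fun i => ?_))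
    rw [if_pos (by positivity)]
    refine le_mul_of_one_le_right' ?_
    have := h.ofReal_rpow_le (a := 0) (b := -b * i) (by have : (0 : ℝ) ≤ i := by positivity
                                                        nlinarith)
    simpa using this
  · obtain ⟨i, h1, h2⟩ : ∃ i : ℕ, R * l ^ (i + 1) ≤ t ∧ t < R * l ^ i := by
      have hex : ∃ n : ℕ, R * l ^ n ≤ t := by
        obtain ⟨n, hn⟩ := exists_pow_lt_of_lt_one (div_pos ht hR) h.lt_one
        exact ⟨n, by rw [lt_div_iff₀' hR] at hn; exact hn.le⟩
      classical
      have h0 : Nat.find hex ≠ 0 := fun h0 => by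
        have := Nat.find_spec hex
        rw [h0, pow_zero, mul_one] at this
        linarith
      refine ⟨Nat.find hex - 1, ?_, not_le.1 (Nat.find_min hex (by omega))⟩
      rw [Nat.sub_add_cancel (by omega)]
      exact Nat.find_spec hex
    refine le_trans ?_ (ENNReal.le_tsum i)
    rw [if_pos h2, mul_comm (-b), ENNReal.rpow_mul, ENNReal.rpow_natCast,
      ← ENNReal.mul_rpow_of_ne_top ENNReal.ofReal_ne_top (by simp), ← ENNReal.ofReal_pow hl.le,
      ← ENNReal.ofReal_mul (by positivity), ENNReal.rpow_neg, ENNReal.rpow_neg,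
      ENNReal.inv_le_inv]
    refine ENNReal.rpow_le_rpow (ENNReal.ofReal_le_ofReal ?_) hb
    rw [mul_assoc, ← pow_succ']
    exact h1

/-- The Morrey type estimate for a power of the distance from a self-similar set. -/
theorem exists_lintegral_le (h : IsSelfSimilar l s g v E) {R b e : ℝ} (hR : 0 < R) (hb : 0 ≤ b)
    (he : 0 ≤ e) (hbe : b + e < Module.finrank ℝ X - s) :
    ∃ A : ℝ≥0∞, A ≠ ⊤ ∧ ∀ y : X, ∫⁻ x in {x | infDist x E < R} ∩ ball y R,
      ENNReal.ofReal (infDist x E) ^ (-b) * ENNReal.ofReal (dist x y) ^ (-(s + e)) ∂μ ≤ A := by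
  obtain ⟨A, hA, hV⟩ := h.exists_measure_near_inter_ball_le μ hR
  have hl := h.pos
  set L := ENNReal.ofReal l
  set lam : ℝ := Module.finrank ℝ X - s
  have hlam : 0 < lam := by linarith
  -- `th` is the midpoint of the interval from `e / lam` to `1 - b / lam`, nonempty because `b + e <
  -- lam`. The bound `max i j ≥ (1 - th) * i + th * j` then separates the double sum into two
  -- convergent geometric series.
  set th := (e / lam + (1 - b / lam)) / 2 with hth
  have hlt : e / lam < 1 - b / lam := by
    rw [lt_sub_iff_add_lt, ← add_div, div_lt_one hlam]
    linarith
  have he' : e < lam * th := by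
    rw [← div_lt_iff₀' hlam]
    linarith
  have hb' : b < lam * (1 - th) := by
    rw [← div_lt_iff₀' hlam]
    linarith
  have hth0 : 0 ≤ th := by have := div_nonneg he hlam.le; linarith
  have hth1 : 0 ≤ 1 - th := by have := div_nonneg hb hlam.le; linarith
  have hLt : ∀ c : ℝ, L ^ c ≠ ⊤ := fun c =>
    ENNReal.rpow_ne_top_of_ne_zero h.ofReal_ne_zero ENNReal.ofReal_ne_top
  set c := ENNReal.ofReal (R * l)
  have hct : ∀ a : ℝ, c ^ a ≠ ⊤ := fun a =>
    ENNReal.rpow_ne_top_of_ne_zero (by simpa [c] using mul_pos hR hl) ENNReal.ofReal_ne_top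
  have hgeom : ∀ a : ℝ, 0 < a → ∑' i : ℕ, L ^ (a * i) ≠ ⊤ := by
    intro a ha
    simp_rw [L, ofReal_rpow_mul_natCast]
    rw [ENNReal.tsum_geometric]
    have : ENNReal.ofReal l ^ a < 1 := ENNReal.rpow_lt_one (by simpa using h.lt_one) ha
    exact ENNReal.inv_ne_top.2 (tsub_pos_of_lt this).ne'
  refine ⟨c ^ (-b) * c ^ (-(s + e)) * A * ((∑' i : ℕ, L ^ ((lam * (1 - th) - b) * i)) *
    ∑' j : ℕ, L ^ ((lam * th - e) * j)), ?_, fun y => ?_⟩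
  · have h1 := hgeom (lam * (1 - th) - b) (by linarith)
    have h2 := hgeom (lam * th - e) (by linarith)
    exact ENNReal.mul_ne_top (ENNReal.mul_ne_top (ENNReal.mul_ne_top (hct _) (hct _)) hA)
      (ENNReal.mul_ne_top h1 h2)
  have hmeas : ∀ a : ℝ, MeasurableSet {x : X | infDist x E < a} := fun a =>
    (isOpen_lt (continuous_infDist_pt E) continuous_const).measurableSet
  calc _ ≤ ∫⁻ x in {x | infDist x E < R} ∩ ball y R, ∑' i : ℕ, ∑' j : ℕ,
        ({x | infDist x E < R * l ^ i} ∩ ball y (R * l ^ j)).indicator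
          (fun _ => c ^ (-b) * L ^ (-b * i) * (c ^ (-(s + e)) * L ^ (-(s + e) * j))) x ∂μ := by
        refine setLIntegral_mono' ((hmeas R).inter measurableSet_ball) fun x hx => ?_
        refine (mul_le_mul' (h.rpow_neg_le_tsum hb infDist_nonneg hx.1)
          (h.rpow_neg_le_tsum (add_nonneg h.dim_nonneg he) dist_nonneg hx.2)).trans_eq ?_
        rw [← ENNReal.tsum_mul_right]
        refine tsum_congr fun i => ?_
        rw [← ENNReal.tsum_mul_left]
        refine tsum_congr fun j => ?_
        by_cases h1 : infDist x E < R * l ^ i <;> by_cases h2 : dist x y < R * l ^ j <;>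
          simp [h1, h2, c, L]
    _ ≤ ∫⁻ x, ∑' i : ℕ, ∑' j : ℕ,
        ({x | infDist x E < R * l ^ i} ∩ ball y (R * l ^ j)).indicator
          (fun _ => c ^ (-b) * L ^ (-b * i) * (c ^ (-(s + e)) * L ^ (-(s + e) * j))) x ∂μ :=
        setLIntegral_le_lintegral _ _
    _ = ∑' i : ℕ, ∑' j : ℕ, c ^ (-b) * L ^ (-b * i) * (c ^ (-(s + e)) * L ^ (-(s + e) * j)) *
          μ ({x | infDist x E < R * l ^ i} ∩ ball y (R * l ^ j)) := by
        have hm : ∀ i j : ℕ, Measurable (({x | infDist x E < R * l ^ i} ∩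
            ball y (R * l ^ j)).indicator (fun _ =>
              c ^ (-b) * L ^ (-b * i) * (c ^ (-(s + e)) * L ^ (-(s + e) * j)))) := fun i j =>
          measurable_const.indicator ((hmeas _).inter measurableSet_ball)
        rw [lintegral_tsum fun i => (Measurable.tsum fun j => hm i j).aemeasurable]
        refine tsum_congr fun i => ?_
        rw [lintegral_tsum fun j => (hm i j).aemeasurable]
        refine tsum_congr fun j => ?_
        rw [lintegral_indicator ((hmeas _).inter measurableSet_ball), setLIntegral_const]
    _ ≤ ∑' i : ℕ, ∑' j : ℕ, c ^ (-b) * c ^ (-(s + e)) * A *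
          (L ^ ((lam * (1 - th) - b) * i) * L ^ ((lam * th - e) * j)) := by
        refine ENNReal.tsum_le_tsum fun i => ENNReal.tsum_le_tsum fun j => ?_
        have h1 : L ^ (s * j + lam * (max i j : ℕ)) ≤
            L ^ (s * j + (lam * (1 - th) * i + lam * th * j)) := by
          refine h.ofReal_rpow_le ?_
          have h2 : (i : ℝ) ≤ (max i j : ℕ) := by exact_mod_cast le_max_left _ _
          have h3 : (j : ℝ) ≤ (max i j : ℕ) := by exact_mod_cast le_max_right _ _
          have h4 := mul_le_mul_of_nonneg_left h2 (mul_nonneg hlam.le hth1)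
          have h5 := mul_le_mul_of_nonneg_left h3 (mul_nonneg hlam.le hth0)
          linarith
        refine (mul_le_mul_right ((hV i j y).trans (mul_le_mul_right h1 A)) _).trans_eq ?_
        have h6 : L ^ ((lam * (1 - th) - b) * i) * L ^ ((lam * th - e) * j) =
            L ^ (-b * i) * L ^ (-(s + e) * j) *
              L ^ (s * j + (lam * (1 - th) * i + lam * th * j)) := by
          rw [← h.ofReal_rpow_add, ← h.ofReal_rpow_add, ← h.ofReal_rpow_add]
          congr 1
          ring
        rw [h6]
        ring
    _ = _ := by
        simp_rw [ENNReal.tsum_mul_left, ENNReal.tsum_mul_right]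

end IsSelfSimilar

/-! ### Layers around a self-similar set and divergence at the critical exponent -/

namespace IsSelfSimilar

variable {X ι : Type*} [NormedAddCommGroup X] [NormedSpace ℝ X] [Fintype ι]
  {l s g : ℝ} {v : ι → X} {E : Set X}

theorem isOpen_layer (E : Set X) (a b : ℝ) : IsOpen {x | a < infDist x E ∧ infDist x E < b} :=
  (isOpen_lt continuous_const (continuous_infDist_pt E)).inter
    (isOpen_lt (continuous_infDist_pt E) continuous_const)

theorem layer_nonempty [Nontrivial X] (h : IsSelfSimilar l s g v E) {a b : ℝ} (ha : 0 ≤ a)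
    (hab : a < b) : {x | a < infDist x E ∧ infDist x E < b}.Nonempty := by
  obtain ⟨e, he⟩ := h.nonempty
  obtain ⟨x, hx⟩ := NormedSpace.exists_lt_norm ℝ X (b + 1)
  have h1 : b ≤ infDist x E := by
    refine (le_infDist h.nonempty).2 fun y hy => ?_
    have := h.subset hy
    rw [mem_closedBall_zero_iff] at this
    have h2 := norm_sub_norm_le x y
    rw [dist_eq_norm]
    linarith
  have h0 : infDist e E ≤ a := by rwa [infDist_zero_of_mem he]
  obtain ⟨z, hz⟩ := intermediate_value_univ (f := fun x => infDist x E) e x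
    (continuous_infDist_pt E) ⟨h0.trans (by linarith : a ≤ (a + b) / 2), by linarith⟩
  simp only at hz
  exact ⟨z, by rw [hz]; linarith, by rw [hz]; linarith⟩

variable [MeasurableSpace X] [BorelSpace X] [FiniteDimensional ℝ X] (μ : Measure X)
  [μ.IsAddHaarMeasure]

theorem measure_infDist_le_zero (h : IsSelfSimilar l s g v E) (hs : s < Module.finrank ℝ X) :
    μ {x | infDist x E ≤ 0} = 0 := by
  have h1 : ∀ m : ℕ, μ {x | infDist x E ≤ 0} ≤
      (ENNReal.ofReal l ^ ((Module.finrank ℝ X : ℝ) - s)) ^ m * μ {x | infDist x E < 1} := by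
    intro m
    have := h.measure_near_le μ 1 m
    rw [ofReal_rpow_mul_natCast] at this
    refine (measure_mono fun x hx => ?_).trans this
    have hl := h.pos
    exact lt_of_le_of_lt (show infDist x E ≤ 0 from hx) (by positivity)
  have h2 : ENNReal.ofReal l ^ ((Module.finrank ℝ X : ℝ) - s) < 1 :=
    ENNReal.rpow_lt_one (by simpa using h.lt_one) (by linarith)
  have h3 := ENNReal.Tendsto.mul_const (ENNReal.tendsto_pow_atTop_nhds_zero_of_lt_one h2)
    (Or.inr (h.measure_near_lt_top μ 1).ne)
  rw [zero_mul] at h3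
  exact le_antisymm (ge_of_tendsto' h3 h1) zero_le

/-- Converse of the covering bound: below the gap scale the copies of a layer are disjoint and
distances to `E` scale exactly, so the volumes add up. -/
theorem measure_layer_mul (h : IsSelfSimilar l s g v E) {a b : ℝ} (hb : 2 * (l * b) ≤ g) :
    ENNReal.ofReal l ^ ((Module.finrank ℝ X : ℝ) - s) *
      μ {x | a < infDist x E ∧ infDist x E < b} ≤
      μ {x | l * a < infDist x E ∧ infDist x E < l * b} := by
  have hl := h.pos
  have hopen : ∀ i, IsOpen ((fun x => l • x + v i) '' {x | a < infDist x E ∧ infDist x E < b}) :=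
    fun i => ((isOpenMap_add_right (v i)).comp (isOpenMap_smul₀ hl.ne')) _ (isOpen_layer E a b)
  calc _ = ∑ i : ι, μ ((fun x => l • x + v i) '' {x | a < infDist x E ∧ infDist x E < b}) := by
        simp_rw [h.measure_map μ]
        rw [Finset.sum_const, nsmul_eq_mul, ← mul_assoc, Finset.card_univ, h.card_mul_rpow]
    _ = μ (⋃ i, (fun x => l • x + v i) '' {x | a < infDist x E ∧ infDist x E < b}) := by
        rw [measure_iUnion (fun i j hij => h.disjoint_images hb hij fun x hx => hx.2)
          fun i => (hopen i).measurableSet, tsum_fintype]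
    _ ≤ _ := by
        refine measure_mono (iUnion_subset fun i => ?_)
        rintro _ ⟨x, ⟨h1, h2⟩, rfl⟩
        simp only [mem_ofPred_eq]
        rw [h.infDist_map hb i h2]
        exact ⟨mul_lt_mul_of_pos_left h1 hl, mul_lt_mul_of_pos_left h2 hl⟩

theorem measure_layer_le (h : IsSelfSimilar l s g v E) {a b : ℝ} (hb0 : 0 ≤ b)
    (hb : 2 * (l * b) ≤ g) (m : ℕ) :
    ENNReal.ofReal l ^ (((Module.finrank ℝ X : ℝ) - s) * m) *
      μ {x | a < infDist x E ∧ infDist x E < b} ≤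
      μ {x | a * l ^ m < infDist x E ∧ infDist x E < b * l ^ m} := by
  rw [ofReal_rpow_mul_natCast]
  induction m with
  | zero => simp
  | succ m ih =>
    have e1 : ∀ c : ℝ, c * l ^ (m + 1) = l * (c * l ^ m) := fun c => by ring
    rw [e1, e1, pow_succ', mul_assoc]
    refine (mul_le_mul_right ih _).trans (h.measure_layer_mul μ ?_)
    refine le_trans ?_ hb
    have := mul_le_of_le_one_right hb0 (pow_le_one₀ h.pos.le h.lt_one.le (n := m))
    nlinarith [h.pos]

/-- The critical power of the distance from a self-similar set is not integrable near the set. -/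
theorem lintegral_eq_top (h : IsSelfSimilar l s g v E) (hs : s < Module.finrank ℝ X) {δ : ℝ}
    (hδ : 0 < δ) :
    ∫⁻ x in {x | 0 < infDist x E ∧ infDist x E < δ},
      ENNReal.ofReal (infDist x E) ^ (-((Module.finrank ℝ X : ℝ) - s)) ∂μ = ⊤ := by
  have hl := h.pos
  have hg := h.gap_pos
  set lam : ℝ := Module.finrank ℝ X - s
  have hlam : 0 < lam := by linarith
  have : Nontrivial X := Module.nontrivial_of_finrank_pos (R := ℝ) (by
    have := h.dim_nonneg.trans_lt hs
    exact_mod_cast this)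
  -- The outer radius stays within `δ` and is small enough for layers to reproduce exactly. Each
  -- layer `S m` below then contributes at least the fixed positive amount `a ^ (-lam) * μ (S 0)`.
  set a := min δ (g / 2) with ha_def
  have ha : 0 < a := lt_min hδ (by linarith)
  have hag : 2 * (l * a) ≤ g := by
    have h1 : a ≤ g / 2 := min_le_right _ _
    have h2 := mul_le_mul_of_nonneg_right h.lt_one.le ha.le
    linarith
  set S : ℕ → Set X := fun m => {x | a * l * l ^ m < infDist x E ∧ infDist x E < a * l ^ m}
  have hS : ∀ m, MeasurableSet (S m) := fun m => (isOpen_layer E _ _).measurableSet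
  have hdisj : Pairwise (Function.onFun Disjoint S) := by
    refine (pairwise_disjoint_on S).2 fun m n hmn => Set.disjoint_left.2 fun x hx hy => ?_
    have h1 : a * l ^ n ≤ a * l ^ (m + 1) :=
      mul_le_mul_of_nonneg_left (pow_le_pow_of_le_one hl.le h.lt_one.le hmn) ha.le
    have h2 : a * l * l ^ m = a * l ^ (m + 1) := by ring
    have h3 : a * l * l ^ m < infDist x E := hx.1
    have h4 : infDist x E < a * l ^ n := hy.2
    linarith
  have hpos : μ (S 0) ≠ 0 := by
    refine ((isOpen_layer E _ _).measure_pos μ (h.layer_nonempty (by positivity) ?_)).ne'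
    have := mul_lt_mul_of_pos_left h.lt_one ha
    simpa using this
  have hsub : ⋃ m, S m ⊆ {x | 0 < infDist x E ∧ infDist x E < δ} := by
    refine iUnion_subset fun m x hx => ⟨lt_of_le_of_lt (by positivity) hx.1, hx.2.trans_le ?_⟩
    exact (mul_le_of_le_one_right ha.le (pow_le_one₀ hl.le h.lt_one.le)).trans (min_le_left _ _)
  refine top_unique ?_
  calc (⊤ : ℝ≥0∞) = ∑' _ : ℕ, ENNReal.ofReal a ^ (-lam) * μ (S 0) := by
        refine (ENNReal.tsum_const_eq_top_of_ne_zero (mul_ne_zero ?_ hpos)).symm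
        simp [ENNReal.rpow_eq_zero_iff, hlam.le.not_gt]
    _ ≤ ∑' m : ℕ, ∫⁻ x in S m, ENNReal.ofReal (infDist x E) ^ (-lam) ∂μ := by
        refine ENNReal.tsum_le_tsum fun m => ?_
        calc _ ≤ ENNReal.ofReal (a * l ^ m) ^ (-lam) * μ (S m) := by
              have h1 := h.measure_layer_le μ (a := a * l) ha.le hag m
              have h2 : ENNReal.ofReal (a * l ^ m) ^ (-lam) =
                  ENNReal.ofReal a ^ (-lam) * ENNReal.ofReal l ^ (-lam * m) := by
                rw [ENNReal.ofReal_mul ha.le, ENNReal.ofReal_pow hl.le, ENNReal.mul_rpow_of_ne_top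
                  ENNReal.ofReal_ne_top (by simp), mul_comm (-lam), ENNReal.rpow_mul,
                  ENNReal.rpow_natCast]
              rw [h2, mul_assoc]
              refine mul_le_mul_right (le_trans ?_ (mul_le_mul_right h1 _)) _
              rw [← mul_assoc, ← h.ofReal_rpow_add]
              have h3 : -lam * m + ((Module.finrank ℝ X : ℝ) - s) * m = 0 := by ring
              rw [h3, ENNReal.rpow_zero, one_mul]
              simp only [S, pow_zero, mul_one, le_refl]
          _ = ∫⁻ x in S m, ENNReal.ofReal (a * l ^ m) ^ (-lam) ∂μ := by rw [setLIntegral_const]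
          _ ≤ _ := by
              refine setLIntegral_mono' (hS m) fun x hx => ?_
              rw [ENNReal.rpow_neg, ENNReal.rpow_neg, ENNReal.inv_le_inv]
              exact ENNReal.rpow_le_rpow (ENNReal.ofReal_le_ofReal hx.2.le) hlam.le
    _ = ∫⁻ x in ⋃ m, S m, ENNReal.ofReal (infDist x E) ^ (-lam) ∂μ :=
        (lintegral_iUnion hS hdisj _).symm
    _ ≤ _ := lintegral_mono_set hsub

end IsSelfSimilar

/-! ### The one-point set -/

/-- This serves integer λ. With a single map the gap condition is vacuous and the dimension is 0, so
the values of the ratio and the gap are immaterial. -/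
theorem isSelfSimilar_singleton {X : Type*} [NormedAddCommGroup X] [NormedSpace ℝ X] :
    IsSelfSimilar (1 / 2) 0 1 (fun _ : Unit => (0 : X)) {0} where
  nonempty := singleton_nonempty _
  subset := by simp
  pos := by norm_num
  lt_one := by norm_num
  dim_nonneg := le_rfl
  card_mul := by simp
  gap_pos := one_pos
  maps := by simp
  cover := by simp
  gap := by simp

/-- The case `E = {0}`, `b = 0` of the Morrey-type estimate. Allowing `t = 0` separately admits the
zero-dimensional space, which occurs as the tail when `k = n`. -/
theorem exists_lintegral_dist_rpow_le {m : ℕ} {t : ℝ} (ht : 0 ≤ t) (htm : t = 0 ∨ t < m) :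
    ∃ A : ℝ≥0∞, A ≠ ⊤ ∧ ∀ y ∈ closedBall (0 : EuclideanSpace ℝ (Fin m)) 1,
      ∫⁻ x in ball 0 1, ENNReal.ofReal (dist x y) ^ (-t) ≤ A := by
  rcases htm with rfl | htm
  · exact ⟨volume (ball (0 : EuclideanSpace ℝ (Fin m)) 1), measure_ball_lt_top.ne, fun y _ => by
      simp⟩
  · obtain ⟨A, hA, h⟩ := (isSelfSimilar_singleton (X := EuclideanSpace ℝ (Fin m))).exists_lintegral_le
      volume (R := 2) (b := 0) (e := t) two_pos le_rfl ht (by simpa using htm)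
    refine ⟨A, hA, fun y hy => le_trans ?_ (h y)⟩
    simp only [neg_zero, ENNReal.rpow_zero, one_mul, zero_add, infDist_singleton]
    refine lintegral_mono_set fun x hx => ?_
    rw [mem_ball] at hx
    rw [mem_closedBall] at hy
    exact ⟨by simp only [mem_ofPred_eq]; linarith,
      by rw [mem_ball]; linarith [dist_triangle_right x y 0]⟩

/-! ### The splitting ℝⁿ = ℝᵏ × ℝⁿ⁻ᵏ and the kernel estimate on the unit ball -/

section Split

variable {n k : ℕ} (h : k ≤ n)

theorem headPart_sub (x y : EuclideanSpace ℝ (Fin n)) :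
    headPart h (x - y) = headPart h x - headPart h y := by
  ext i; simp [headPart]

theorem tailPart_sub (x y : EuclideanSpace ℝ (Fin n)) :
    tailPart h (x - y) = tailPart h x - tailPart h y := by
  ext i; simp [tailPart]

/-- The isometry `x ↦ (x', x'')`. -/
noncomputable def splitIso : EuclideanSpace ℝ (Fin n) ≃ₗᵢ[ℝ]
    WithLp 2 (EuclideanSpace ℝ (Fin k) × EuclideanSpace ℝ (Fin (n - k))) :=
  (LinearIsometryEquiv.piLpCongrLeft 2 ℝ ℝ
    (finSumFinEquiv.trans (finCongr (Nat.add_sub_cancel' h))).symm).trans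
      (PiLp.sumPiLpEquivProdLpPiLp 2 (fun _ : Fin k ⊕ Fin (n - k) => ℝ))

theorem splitIso_apply (x : EuclideanSpace ℝ (Fin n)) :
    splitIso h x = WithLp.toLp 2 (headPart h x, tailPart h x) := by
  apply WithLp.ofLp_injective
  ext i <;> simp [splitIso, headPart, tailPart] <;> rfl

theorem norm_sq_eq_headPart_add_tailPart (x : EuclideanSpace ℝ (Fin n)) :
    ‖x‖ ^ 2 = ‖headPart h x‖ ^ 2 + ‖tailPart h x‖ ^ 2 := by
  rw [← (splitIso h).norm_map x, splitIso_apply, WithLp.prod_norm_sq_eq_of_L2]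
  rfl

theorem norm_headPart_le (x : EuclideanSpace ℝ (Fin n)) : ‖headPart h x‖ ≤ ‖x‖ := by
  refine le_of_sq_le_sq ?_ (norm_nonneg _)
  nlinarith [norm_sq_eq_headPart_add_tailPart h x]

theorem norm_tailPart_le (x : EuclideanSpace ℝ (Fin n)) : ‖tailPart h x‖ ≤ ‖x‖ := by
  refine abs_le_of_sq_le_sq' ?_ (norm_nonneg _) |>.2
  nlinarith [norm_sq_eq_headPart_add_tailPart h x]

theorem dist_headPart_le (x y : EuclideanSpace ℝ (Fin n)) :
    dist (headPart h x) (headPart h y) ≤ dist x y := by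
  rw [dist_eq_norm, dist_eq_norm, ← headPart_sub]
  exact norm_headPart_le h _

theorem dist_tailPart_le (x y : EuclideanSpace ℝ (Fin n)) :
    dist (tailPart h x) (tailPart h y) ≤ dist x y := by
  rw [dist_eq_norm, dist_eq_norm, ← tailPart_sub]
  exact norm_tailPart_le h _

theorem continuous_headPart : Continuous (headPart h) :=
  (LipschitzWith.of_dist_le_mul (K := 1) fun x y => by simpa using dist_headPart_le h x y).continuous

theorem continuous_tailPart : Continuous (tailPart h) :=
  (LipschitzWith.of_dist_le_mul (K := 1) fun x y => by simpa using dist_tailPart_le h x y).continuous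

theorem measurePreserving_split :
    MeasurePreserving (fun x => (headPart h x, tailPart h x)) volume volume := by
  have := (WithLp.volume_preserving_ofLp (EuclideanSpace ℝ (Fin k))
    (EuclideanSpace ℝ (Fin (n - k)))).comp (splitIso h).measurePreserving
  convert! this using 1

theorem lintegral_headPart_mul_tailPart {S : Set (EuclideanSpace ℝ (Fin k))}
    {T : Set (EuclideanSpace ℝ (Fin (n - k)))} (hS : MeasurableSet S) (hT : MeasurableSet T)
    {f : EuclideanSpace ℝ (Fin k) → ℝ≥0∞} {g : EuclideanSpace ℝ (Fin (n - k)) → ℝ≥0∞}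
    (hf : Measurable f) (hg : Measurable g) :
    ∫⁻ x in {x | headPart h x ∈ S ∧ tailPart h x ∈ T}, f (headPart h x) * g (tailPart h x) =
      (∫⁻ z in S, f z) * ∫⁻ w in T, g w := by
  have h1 := (measurePreserving_split h).setLIntegral_comp_preimage (hS.prod hT)
    (f := fun z => f z.1 * g z.2) (by fun_prop)
  rw [Measure.volume_eq_prod, ← Measure.prod_restrict, lintegral_prod_mul hf.aemeasurable
    hg.aemeasurable] at h1
  exact h1

end Split

theorem ENNReal.rpow_neg_le_rpow_neg {a b : ℝ≥0∞} {t : ℝ} (hab : a ≤ b) (ht : 0 ≤ t) :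
    b ^ (-t) ≤ a ^ (-t) := by
  rw [ENNReal.rpow_neg, ENNReal.rpow_neg, ENNReal.inv_le_inv]
  exact ENNReal.rpow_le_rpow hab ht

/-- Both projections contract distances, so the kernel is dominated by a product for any division of
its exponent, and the integral factors. -/
theorem enorm_rpow_le_headPart_mul_tailPart {n k : ℕ} (h : k ≤ n) {a b : ℝ} (ha : 0 ≤ a)
    (hb : 0 ≤ b) (x y : EuclideanSpace ℝ (Fin n)) :
    ‖x - y‖ₑ ^ (-(a + b)) ≤ ENNReal.ofReal (dist (headPart h x) (headPart h y)) ^ (-a) *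
      ENNReal.ofReal (dist (tailPart h x) (tailPart h y)) ^ (-b) := by
  have h1 : ENNReal.ofReal (dist (headPart h x) (headPart h y)) ≤ ‖x - y‖ₑ := by
    rw [← ofReal_norm, ← dist_eq_norm]
    exact ENNReal.ofReal_le_ofReal (dist_headPart_le h x y)
  have h2 : ENNReal.ofReal (dist (tailPart h x) (tailPart h y)) ≤ ‖x - y‖ₑ := by
    rw [← ofReal_norm, ← dist_eq_norm]
    exact ENNReal.ofReal_le_ofReal (dist_tailPart_le h x y)
  refine le_trans ?_ (mul_le_mul' (ENNReal.rpow_neg_le_rpow_neg h1 ha)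
    (ENNReal.rpow_neg_le_rpow_neg h2 hb))
  rw [ENNReal.rpow_neg, ENNReal.rpow_neg, ENNReal.rpow_neg,
    ENNReal.rpow_add_of_nonneg _ _ ha hb, ENNReal.mul_inv]
  · exact Or.inr (ENNReal.rpow_ne_top_of_nonneg hb enorm_ne_top)
  · exact Or.inl (ENNReal.rpow_ne_top_of_nonneg ha enorm_ne_top)

namespace IsSelfSimilar

variable {n k : ℕ} {ι : Type*} [Fintype ι] {l s g : ℝ} {v : ι → EuclideanSpace ℝ (Fin k)}
  {E : Set (EuclideanSpace ℝ (Fin k))}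

theorem infDist_headPart_lt_two (hE : IsSelfSimilar l s g v E) (h : k ≤ n)
    {x : EuclideanSpace ℝ (Fin n)} (hx : x ∈ ball 0 1) : infDist (headPart h x) E < 2 := by
  obtain ⟨e, he⟩ := hE.nonempty
  have h1 := hE.subset he
  rw [mem_closedBall_zero_iff] at h1
  rw [mem_ball_zero_iff] at hx
  refine (infDist_le_dist_of_mem he).trans_lt ?_
  rw [dist_eq_norm]
  linarith [norm_sub_le (headPart h x) e, norm_headPart_le h x]

theorem exists_lintegral_ball_le (hE : IsSelfSimilar l s g v E) (h : k ≤ n) {b : ℝ} (hb : 0 ≤ b)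
    (hbs : b < k - s) :
    ∃ A : ℝ≥0∞, A ≠ ⊤ ∧ ∀ y ∈ closedBall (0 : EuclideanSpace ℝ (Fin n)) 1,
      ∫⁻ x in ball 0 1, ENNReal.ofReal (infDist (headPart h x) E) ^ (-b) *
        ‖x - y‖ₑ ^ (k - s - n : ℝ) ≤ A := by
  -- The exponent n − λ = s + (n − k) is divided as (s + e) + ((n − k) − e). For k < n a positive e
  -- makes the tail factor integrable, while b + e < k − s keeps the head factor bounded. For k = n,
  -- e = 0 and the tail is trivial.
  set e : ℝ := min ((k - s - b) / 2) (n - k : ℕ)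
  have he0 : 0 ≤ e := le_min (by linarith) (by positivity)
  have he1 : b + e < k - s := by
    have : e ≤ (k - s - b) / 2 := min_le_left _ _
    linarith
  have he2 : e ≤ (n - k : ℕ) := min_le_right _ _
  have he3 : ((n - k : ℕ) : ℝ) - e = 0 ∨ ((n - k : ℕ) : ℝ) - e < (n - k : ℕ) := by
    rcases (Nat.zero_le (n - k)).eq_or_lt with h0 | h0
    · left
      rw [← h0] at he2 ⊢
      push_cast at he2 ⊢
      linarith
    · right
      have : 0 < e := lt_min (by linarith) (by exact_mod_cast h0)
      linarith
  obtain ⟨A, hA, hA'⟩ := hE.exists_lintegral_le volume (R := 2) two_pos hb he0 (by simpa using he1)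
  obtain ⟨B, hB, hB'⟩ := exists_lintegral_dist_rpow_le (sub_nonneg.2 he2) he3
  refine ⟨A * B, ENNReal.mul_ne_top hA hB, fun y hy => ?_⟩
  rw [mem_closedBall_zero_iff] at hy
  have hexp : (k - s - n : ℝ) = -((s + e) + (((n - k : ℕ) : ℝ) - e)) := by
    rw [Nat.cast_sub h]
    ring
  set S : Set (EuclideanSpace ℝ (Fin k)) := {z | infDist z E < 2} ∩ ball (headPart h y) 2
  have hS : MeasurableSet S := (isOpen_lt (continuous_infDist_pt E)
    continuous_const).measurableSet.inter measurableSet_ball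
  calc _ ≤ ∫⁻ x in {x | headPart h x ∈ S ∧ tailPart h x ∈ ball 0 1},
        (ENNReal.ofReal (infDist (headPart h x) E) ^ (-b) *
          ENNReal.ofReal (dist (headPart h x) (headPart h y)) ^ (-(s + e))) *
        ENNReal.ofReal (dist (tailPart h x) (tailPart h y)) ^ (-(((n - k : ℕ) : ℝ) - e)) := by
        refine (lintegral_mono_set fun x hx => ?_).trans (lintegral_mono fun x => ?_)
        · refine ⟨⟨hE.infDist_headPart_lt_two h hx, ?_⟩, ?_⟩
          · rw [mem_ball_zero_iff] at hx
            rw [mem_ball, dist_eq_norm, ← headPart_sub]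
            linarith [norm_headPart_le h (x - y), norm_sub_le x y]
          · rw [mem_ball_zero_iff] at hx ⊢
            exact (norm_tailPart_le h x).trans_lt hx
        · rw [mul_assoc, hexp]
          exact mul_le_mul_right (enorm_rpow_le_headPart_mul_tailPart h
            (add_nonneg hE.dim_nonneg he0) (sub_nonneg.2 he2) x y) _
    _ = (∫⁻ z in S, ENNReal.ofReal (infDist z E) ^ (-b) *
          ENNReal.ofReal (dist z (headPart h y)) ^ (-(s + e))) *
        ∫⁻ w in ball 0 1, ENNReal.ofReal (dist w (tailPart h y)) ^ (-(((n - k : ℕ) : ℝ) - e)) := by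
        refine lintegral_headPart_mul_tailPart h hS measurableSet_ball
          (f := fun z => ENNReal.ofReal (infDist z E) ^ (-b) *
            ENNReal.ofReal (dist z (headPart h y)) ^ (-(s + e)))
          (g := fun w => ENNReal.ofReal (dist w (tailPart h y)) ^ (-(((n - k : ℕ) : ℝ) - e))) ?_ ?_
        · have := (continuous_infDist_pt E).measurable
          fun_prop
        · fun_prop
    _ ≤ A * B := by
        refine mul_le_mul' (hA' _) (hB' _ ?_)
        rw [mem_closedBall_zero_iff]
        exact (norm_tailPart_le h y).trans hy

end IsSelfSimilar

/-! ### Truncated powers of the distance: support and pointwise bounds -/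

theorem abs_rpow_neg_sub_rpow_neg_le {a b m α : ℝ} (hα : 0 ≤ α) (hm : 0 < m) (ha : m ≤ a)
    (hb : m ≤ b) : |a ^ (-α) - b ^ (-α)| ≤ α * m ^ (-(α + 1)) * |a - b| := by
  have := (convex_Ici m).norm_image_sub_le_of_norm_hasDerivWithin_le
    (f := fun t => t ^ (-α)) (f' := fun t => -α * t ^ (-α - 1)) (C := α * m ^ (-(α + 1)))
    (fun t ht => (Real.hasDerivAt_rpow_const (Or.inl (hm.trans_le ht).ne')).hasDerivWithinAt)
    (fun t ht => ?_) hb ha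
  · simpa [Real.norm_eq_abs] using this
  · have ht' : 0 < t := hm.trans_le ht
    rw [norm_mul, Real.norm_eq_abs, Real.norm_eq_abs, abs_neg, abs_of_nonneg hα,
      abs_of_pos (by positivity), ← neg_add']
    refine mul_le_mul_of_nonneg_left ?_ hα
    exact Real.rpow_le_rpow_of_nonpos hm ht (by linarith)

/-- The function `(max (dist(x', E)) δ ^ (-α) - c ^ α)₊ ξ(|x''|)`. -/
noncomputable def truncPower {n k : ℕ} (h : k ≤ n) (E : Set (EuclideanSpace ℝ (Fin k)))
    (c α δ : ℝ) (ξ : ℝ → ℝ) (x : EuclideanSpace ℝ (Fin n)) : ℝ :=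
  max (max (infDist (headPart h x) E) δ ^ (-α) - c ^ α) 0 * ξ ‖tailPart h x‖

namespace truncPower

variable {n k : ℕ} {h : k ≤ n} {E : Set (EuclideanSpace ℝ (Fin k))} {c α δ : ℝ} {ξ : ℝ → ℝ}

theorem abs_infDist_headPart_sub_le (x y : EuclideanSpace ℝ (Fin n)) :
    |infDist (headPart h x) E - infDist (headPart h y) E| ≤ dist x y := by
  have := (lipschitz_infDist_pt E).dist_le_mul (headPart h x) (headPart h y)
  rw [NNReal.coe_one, one_mul, Real.dist_eq] at this
  exact this.trans (dist_headPart_le h x y)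

theorem continuous_infDist_headPart :
    Continuous fun x : EuclideanSpace ℝ (Fin n) => infDist (headPart h x) E :=
  (continuous_infDist_pt E).comp (continuous_headPart h)

theorem bump_le (hc : 0 ≤ c) {m t : ℝ} (hα : 0 ≤ α) (hm : 0 < m) (ht : m ≤ t) :
    max (t ^ (-α) - c ^ α) 0 ≤ m ^ (-α) := by
  refine max_le ?_ (by positivity)
  have h1 := Real.rpow_le_rpow_of_nonpos hm ht (by linarith : -α ≤ 0)
  have h2 := Real.rpow_nonneg hc α
  linarith

/-- The product rule for Lipschitz functions, valid wherever the truncated distances are at least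
`m`. Taking `m = δ` gives the global Lipschitz constant; taking half the distance at a point gives
the gradient bound there. -/
theorem abs_sub_le (hξ : IsCutoff ξ) {K : ℝ≥0} (hK : LipschitzOnWith K ξ (Ici 0)) (hc : 0 ≤ c)
    (hα : 0 ≤ α) {m : ℝ} (hm : 0 < m) {x y : EuclideanSpace ℝ (Fin n)}
    (hx : m ≤ max (infDist (headPart h x) E) δ) (hy : m ≤ max (infDist (headPart h y) E) δ) :
    |truncPower h E c α δ ξ x - truncPower h E c α δ ξ y| ≤
      (α * m ^ (-(α + 1)) + K * m ^ (-α)) * dist x y := by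
  unfold truncPower
  set a := max (infDist (headPart h x) E) δ
  set b := max (infDist (headPart h y) E) δ
  have hab : |a - b| ≤ dist x y :=
    (abs_max_sub_max_le_abs _ _ _).trans (abs_infDist_headPart_sub_le x y)
  have h1 : |max (a ^ (-α) - c ^ α) 0 - max (b ^ (-α) - c ^ α) 0| ≤
      α * m ^ (-(α + 1)) * dist x y := by
    refine (abs_max_sub_max_le_abs _ _ _).trans ?_
    rw [sub_sub_sub_cancel_right]
    exact (abs_rpow_neg_sub_rpow_neg_le hα hm hx hy).trans
      (mul_le_mul_of_nonneg_left hab (by positivity))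
  have h2 : |ξ ‖tailPart h x‖ - ξ ‖tailPart h y‖| ≤ K * dist x y := by
    have := hK.dist_le_mul _ (norm_nonneg (tailPart h x)) _ (norm_nonneg (tailPart h y))
    rw [Real.dist_eq, Real.dist_eq] at this
    refine this.trans (mul_le_mul_of_nonneg_left ?_ K.2)
    refine (abs_norm_sub_norm_le _ _).trans ?_
    rw [← dist_eq_norm]
    exact dist_tailPart_le h x y
  have h3 := bump_le hc hα hm hy
  have h4 : 0 ≤ max (b ^ (-α) - c ^ α) 0 := le_max_right _ _
  obtain ⟨h5, h6⟩ := hξ.mem_Icc _ (norm_nonneg (tailPart h x))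
  set A := max (a ^ (-α) - c ^ α) 0
  set B := max (b ^ (-α) - c ^ α) 0
  set X := ξ ‖tailPart h x‖
  set Y := ξ ‖tailPart h y‖
  calc |A * X - B * Y| = |(A - B) * X + B * (X - Y)| := by ring_nf
    _ ≤ |A - B| * X + B * |X - Y| := by
        refine (abs_add_le _ _).trans_eq ?_
        rw [abs_mul, abs_mul, abs_of_nonneg h5, abs_of_nonneg h4]
    _ ≤ α * m ^ (-(α + 1)) * dist x y * 1 + m ^ (-α) * (K * dist x y) := by
        gcongr
    _ = _ := by ring

theorem exists_lipschitzWith (hξ : IsCutoff ξ) (hc : 0 ≤ c) (hα : 0 ≤ α) (hδ : 0 < δ) :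
    ∃ K : ℝ≥0, LipschitzWith K (truncPower h E c α δ ξ) := by
  obtain ⟨K, hK⟩ := hξ.lipschitz
  refine ⟨⟨α * δ ^ (-(α + 1)) + K * δ ^ (-α), by positivity⟩,
    LipschitzWith.of_dist_le_mul fun x y => ?_⟩
  exact abs_sub_le hξ hK hc hα hδ (le_max_right _ _) (le_max_right _ _)

/-- Off the unit ball |x'|² + |x''|² ≥ 1, so either |x''|² > 1/3 and the cutoff vanishes, or |x'|² ≥
2/3 and the distance to `E` exceeds 1/c. Both alternatives are arranged as open conditions, so the
gradient vanishes as well, even on the unit sphere. -/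
theorem eventually_eq_zero (hξ : IsCutoff ξ) (hc : 0 < c) (hα : 0 < α)
    (hE : ∀ z, infDist z E ≤ 1 / c → ‖z‖ ^ 2 < 2 / 3) {x : EuclideanSpace ℝ (Fin n)}
    (hx : x ∉ ball 0 1) : ∀ᶠ y in nhds x, truncPower h E c α δ ξ y = 0 := by
  have h1 : 1 / c < infDist (headPart h x) E ∨ √3 / 3 < ‖tailPart h x‖ := by
    by_contra! hcon
    have h2 := hE _ hcon.1
    have h3 : ‖tailPart h x‖ ^ 2 ≤ (√3 / 3) ^ 2 := pow_le_pow_left₀ (norm_nonneg _) hcon.2 2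
    have h4 := norm_sq_eq_headPart_add_tailPart h x
    rw [div_pow, Real.sq_sqrt (by norm_num)] at h3
    rw [mem_ball_zero_iff] at hx
    have h5 : 1 ≤ ‖x‖ := not_lt.1 hx
    nlinarith
  rcases h1 with h1 | h1
  · filter_upwards [(continuous_infDist_headPart (h := h) (E := E)).continuousAt.eventually
      (lt_mem_nhds h1)] with y hy
    unfold truncPower
    have h2 : 1 / c ≤ max (infDist (headPart h y) E) δ := hy.le.trans (le_max_left _ _)
    have h3 := Real.rpow_le_rpow_of_nonpos (by positivity) h2 (by linarith : -α ≤ 0)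
    rw [one_div, Real.inv_rpow hc.le, Real.rpow_neg hc.le, inv_inv] at h3
    rw [max_eq_right (by linarith), zero_mul]
  · filter_upwards [(continuous_tailPart h).norm.continuousAt.eventually (lt_mem_nhds h1)] with y hy
    unfold truncPower
    rw [hξ.eq_zero _ (le_of_lt hy), mul_zero]

theorem eq_zero (hξ : IsCutoff ξ) (hc : 0 < c) (hα : 0 < α)
    (hE : ∀ z, infDist z E ≤ 1 / c → ‖z‖ ^ 2 < 2 / 3) {x : EuclideanSpace ℝ (Fin n)}
    (hx : x ∉ ball 0 1) : truncPower h E c α δ ξ x = 0 :=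
  (eventually_eq_zero hξ hc hα hE hx).self_of_nhds

theorem gradient_eq_zero (hξ : IsCutoff ξ) (hc : 0 < c) (hα : 0 < α)
    (hE : ∀ z, infDist z E ≤ 1 / c → ‖z‖ ^ 2 < 2 / 3) {x : EuclideanSpace ℝ (Fin n)}
    (hx : x ∉ ball 0 1) : gradient (truncPower h E c α δ ξ) x = 0 := by
  have h1 : truncPower h E c α δ ξ =ᶠ[nhds x] fun _ => (0 : ℝ) := eventually_eq_zero hξ hc hα hE hx
  rw [h1.gradient_eq]
  simp [gradient]

/-- Near `x` the distance to `E` stays above half its value at `x`, and a local Lipschitz bound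
controls `gradient` without any differentiability. -/
theorem norm_gradient_le (hξ : IsCutoff ξ) {K : ℝ≥0} (hK : LipschitzOnWith K ξ (Ici 0))
    (hc : 0 ≤ c) (hα : 0 ≤ α) {x : EuclideanSpace ℝ (Fin n)}
    (hx : 0 < infDist (headPart h x) E) :
    ‖gradient (truncPower h E c α δ ξ) x‖ ≤
      α * (infDist (headPart h x) E / 2) ^ (-(α + 1)) +
        K * (infDist (headPart h x) E / 2) ^ (-α) := by
  rw [gradient, LinearIsometryEquiv.norm_map]
  refine norm_fderiv_le_of_lip' ℝ (by positivity) ?_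
  filter_upwards [(continuous_infDist_headPart (h := h) (E := E)).continuousAt.eventually
    (lt_mem_nhds (half_lt_self hx))] with y hy
  rw [Real.norm_eq_abs, ← dist_eq_norm]
  exact abs_sub_le hξ hK hc hα (half_pos hx) (le_of_lt (hy.trans_le (le_max_left _ _)))
    ((half_lt_self hx).le.trans (le_max_left _ _))

theorem abs_le (hξ : IsCutoff ξ) (hc : 0 ≤ c) (hα : 0 ≤ α) {x : EuclideanSpace ℝ (Fin n)}
    (hx : 0 < infDist (headPart h x) E) :
    |truncPower h E c α δ ξ x| ≤ infDist (headPart h x) E ^ (-α) := by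
  unfold truncPower
  obtain ⟨h5, h6⟩ := hξ.mem_Icc _ (norm_nonneg (tailPart h x))
  rw [abs_mul, abs_of_nonneg h5, abs_of_nonneg (le_max_right _ _)]
  exact (mul_le_of_le_one_right (le_max_right _ _) h6).trans (bump_le hc hα hx (le_max_left _ _))

/-- The functions `truncPower` and their gradients have a common bound. -/
theorem exists_bound (hξ : IsCutoff ξ) (hc : 0 < c) (hα : 0 < α)
    (hE : ∀ z, infDist z E ≤ 1 / c → ‖z‖ ^ 2 < 2 / 3)
    (hE2 : ∀ x ∈ ball (0 : EuclideanSpace ℝ (Fin n)) 1, infDist (headPart h x) E < 2) :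
    ∃ C : ℝ, 0 < C ∧ ∀ (δ : ℝ) (x : EuclideanSpace ℝ (Fin n)), 0 < infDist (headPart h x) E →
      ‖truncPower h E c α δ ξ x‖ ≤
        (ball 0 1).indicator (fun x => C * infDist (headPart h x) E ^ (-(α + 1))) x ∧
      ‖gradient (truncPower h E c α δ ξ) x‖ ≤
        (ball 0 1).indicator (fun x => C * infDist (headPart h x) E ^ (-(α + 1))) x := by
  obtain ⟨K, hK⟩ := hξ.lipschitz
  have h20 : (0 : ℝ) < 2 ^ (α + 1) := by positivity
  refine ⟨(α + K) * 2 ^ (α + 1) + 2, by positivity, fun δ x hx => ?_⟩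
  by_cases hxb : x ∈ ball 0 1
  · have hd2 := hE2 x hxb
    rw [indicator_of_mem hxb]
    set d := infDist (headPart h x) E
    have hd : 0 < d ^ (-(α + 1)) := by positivity
    have h1 : d ^ (-α) ≤ 2 * d ^ (-(α + 1)) := by
      have : d ^ (-α) = d * d ^ (-(α + 1)) := by
        rw [← Real.rpow_one_add' hx.le (by linarith)]
        congr 1
        ring
      rw [this]
      exact mul_le_mul_of_nonneg_right hd2.le hd.le
    have h2 : (d / 2) ^ (-α) ≤ (d / 2) ^ (-(α + 1)) :=
      Real.rpow_le_rpow_of_exponent_ge (by positivity) (by linarith) (by linarith)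
    have h3 : (d / 2) ^ (-(α + 1)) = 2 ^ (α + 1) * d ^ (-(α + 1)) := by
      rw [Real.div_rpow hx.le (by norm_num), Real.rpow_neg (by norm_num : (0 : ℝ) ≤ 2), div_inv_eq_mul,
        mul_comm]
    constructor
    · refine (abs_le hξ hc.le hα.le hx).trans (h1.trans ?_)
      refine mul_le_mul_of_nonneg_right ?_ hd.le
      have := K.2
      have : 0 ≤ (α + K) * 2 ^ (α + 1) := by positivity
      linarith
    · refine (norm_gradient_le hξ hK hc.le hα.le hx).trans ?_
      change α * (d / 2) ^ (-(α + 1)) + K * (d / 2) ^ (-α) ≤ _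
      calc _ ≤ α * (d / 2) ^ (-(α + 1)) + K * (d / 2) ^ (-(α + 1)) := by gcongr
        _ = (α + K) * 2 ^ (α + 1) * d ^ (-(α + 1)) := by rw [h3]; ring
        _ ≤ _ := by
          refine mul_le_mul_of_nonneg_right ?_ hd.le
          linarith
  · rw [indicator_of_notMem hxb, eq_zero hξ hc hα hE hxb, gradient_eq_zero hξ hc hα hE hxb]
    simp

end truncPower

/-! ### Comparison of the norms, and weak gradients of Lipschitz functions -/

theorem tripleNorm_mono_bound {n : ℕ} {p lam : ℝ} (hp : 0 ≤ p)
    {F : EuclideanSpace ℝ (Fin n) → EuclideanSpace ℝ (Fin n)}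
    {G : EuclideanSpace ℝ (Fin n) → ℝ≥0∞} {A : ℝ≥0∞}
    (hFG : ∀ x ∈ ball 0 1, ‖F x‖ₑ ≤ G x)
    (hA : ∀ y ∈ closedBall (0 : EuclideanSpace ℝ (Fin n)) 1,
      ∫⁻ x in ball 0 1, G x ^ p * ‖x - y‖ₑ ^ (lam - n) ≤ A) :
    tripleNorm p lam (ball 0 1) F ≤ A ^ (1 / p) := by
  refine ENNReal.rpow_le_rpow (iSup₂_le fun y hy => le_trans ?_ (hA y (closure_ball_subset_closedBall hy)))
    (by positivity)
  refine setLIntegral_mono' measurableSet_ball fun x hx => ?_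
  exact mul_le_mul_left (ENNReal.rpow_le_rpow (hFG x hx) hp) _

/-- On B_r(y) one has |x − y| < r, hence r^(λ-n) ≤ |x − y|^(λ-n) because λ ≤ n. -/
theorem morreyNorm_le_tripleNorm {n : ℕ} {p lam : ℝ} (hp : 0 ≤ p) (hlam : lam ≤ n)
    {Ω : Set (EuclideanSpace ℝ (Fin n))} (hΩ : MeasurableSet Ω)
    (F : EuclideanSpace ℝ (Fin n) → EuclideanSpace ℝ (Fin n)) :
    morreyNorm p lam Ω F ≤ tripleNorm p lam Ω F := by
  refine ENNReal.rpow_le_rpow (iSup₂_le fun r hr => iSup₂_le fun y hy =>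
    le_trans ?_ (le_iSup₂_of_le y hy le_rfl)) (by positivity)
  rw [← lintegral_const_mul' _ _ ENNReal.ofReal_ne_top]
  refine le_trans ?_ (lintegral_mono_set (inter_subset_left (t := ball y r)))
  refine setLIntegral_mono' (hΩ.inter measurableSet_ball) fun x hx => ?_
  rw [mul_comm, ← ENNReal.ofReal_rpow_of_pos hr, ← neg_sub (n : ℝ) lam]
  refine mul_le_mul_right (ENNReal.rpow_neg_le_rpow_neg ?_ (sub_nonneg.2 hlam)) _
  rw [← ofReal_norm, ← dist_eq_norm]
  exact ENNReal.ofReal_le_ofReal (le_of_lt hx.2)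

theorem gradient_apply_eq_fderiv {n : ℕ} (u : EuclideanSpace ℝ (Fin n) → ℝ)
    (x : EuclideanSpace ℝ (Fin n)) (i : Fin n) :
    gradient u x i = fderiv ℝ u x (EuclideanSpace.single i 1) := by
  have h1 : inner ℝ (gradient u x) (EuclideanSpace.single i 1) = gradient u x i := by
    rw [EuclideanSpace.inner_single_right]
    simp
  rw [← h1, gradient, InnerProductSpace.toDual_symm_apply]

/-- Rademacher's theorem identifies the gradient with line derivatives almost everywhere, and for
these integration by parts is available. -/
theorem LipschitzWith.integral_mul_fderiv_eq {n : ℕ} {u : EuclideanSpace ℝ (Fin n) → ℝ} {K : ℝ≥0}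
    (hu : LipschitzWith K u) {φ : EuclideanSpace ℝ (Fin n) → ℝ} (hφ : ContDiff ℝ ∞ φ)
    (hc : HasCompactSupport φ) (i : Fin n) :
    ∫ x, u x * fderiv ℝ φ x (EuclideanSpace.single i 1) = -∫ x, gradient u x i * φ x := by
  obtain ⟨D, hD⟩ := ContDiff.lipschitzWith_of_hasCompactSupport hc hφ (by simp)
  have h1 := hu.integral_lineDeriv_mul_eq (μ := volume) hD hc (EuclideanSpace.single i 1)
  have h2 : ∀ᵐ x, gradient u x i * φ x =
      lineDeriv ℝ u x (EuclideanSpace.single i 1) * φ x := by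
    filter_upwards [hu.ae_differentiableAt (μ := volume)] with x hx
    rw [gradient_apply_eq_fderiv, hx.lineDeriv_eq_fderiv]
  rw [integral_congr_ae h2, h1, ← integral_neg]
  congr 1
  funext x
  rw [((hφ.differentiable (by simp)) x).lineDeriv_eq_fderiv, map_neg]
  ring

theorem measurable_gradient {n : ℕ} (u : EuclideanSpace ℝ (Fin n) → ℝ) :
    Measurable (gradient u) :=
  (InnerProductSpace.toDual ℝ (EuclideanSpace ℝ (Fin n))).symm.continuous.measurable.comp
    (measurable_fderiv ℝ u)

/-! ### Removing the truncation: weak gradient, infinite norm, counterexamples -/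

namespace truncPower

variable {n k : ℕ} {h : k ≤ n} {E : Set (EuclideanSpace ℝ (Fin k))} {c α δ : ℝ} {ξ : ℝ → ℝ}

protected theorem measurable (hξ : IsCutoff ξ) : Measurable (truncPower h E c α δ ξ) := by
  obtain ⟨K, hK⟩ := hξ.lipschitz
  have h1 : Continuous fun x : EuclideanSpace ℝ (Fin n) => ξ ‖tailPart h x‖ :=
    hK.continuousOn.comp_continuous (continuous_tailPart h).norm fun x => norm_nonneg _
  have h2 := (continuous_infDist_headPart (h := h) (E := E)).measurable
  have h3 := h1.measurable
  exact (((h2.max measurable_const).pow_const _).sub_const _ |>.max measurable_const).mul h3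

theorem eventuallyEq_zero_delta {x : EuclideanSpace ℝ (Fin n)} {δ : ℝ} (hδ : 0 ≤ δ)
    (hx : δ < infDist (headPart h x) E) :
    truncPower h E c α δ ξ =ᶠ[nhds x] truncPower h E c α 0 ξ := by
  filter_upwards [(continuous_infDist_headPart (h := h) (E := E)).continuousAt.eventually
    (lt_mem_nhds hx)] with y hy
  have hy' : δ < infDist (headPart h y) E := hy
  unfold truncPower
  rw [max_eq_left hy'.le, max_eq_left (hδ.trans hy'.le)]

/-- Off the singular set the truncations are eventually equal to the limit on a whole neighbourhood,
so values and gradients converge trivially at almost every point. -/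
theorem eventually_eventuallyEq {x : EuclideanSpace ℝ (Fin n)}
    (hx : 0 < infDist (headPart h x) E) :
    ∀ᶠ j : ℕ in Filter.atTop,
      truncPower h E c α (1 / ((j : ℝ) + 1)) ξ =ᶠ[nhds x] truncPower h E c α 0 ξ := by
  filter_upwards [tendsto_one_div_add_atTop_nhds_zero_nat.eventually (gt_mem_nhds hx)] with j hj
  exact eventuallyEq_zero_delta (by positivity) hj

end truncPower

namespace IsSelfSimilar

variable {n k : ℕ} {ι : Type*} [Fintype ι] {l s g : ℝ} {v : ι → EuclideanSpace ℝ (Fin k)}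
  {E : Set (EuclideanSpace ℝ (Fin k))}

theorem ae_infDist_headPart_pos (hE : IsSelfSimilar l s g v E) (hs : s < k) (h : k ≤ n) :
    ∀ᵐ x : EuclideanSpace ℝ (Fin n), 0 < infDist (headPart h x) E := by
  have h1 : volume ({z | infDist z E ≤ 0} ×ˢ univ :
      Set (EuclideanSpace ℝ (Fin k) × EuclideanSpace ℝ (Fin (n - k)))) = 0 := by
    rw [Measure.volume_eq_prod, Measure.prod_prod,
      hE.measure_infDist_le_zero volume (by simpa using hs), zero_mul]
  have h2 := (measurePreserving_split h).quasiMeasurePreserving.preimage_null h1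
  rw [ae_iff]
  convert! h2 using 2
  ext x
  simp

variable {c α p q : ℝ} {ξ : ℝ → ℝ}

theorem exists_bound (hE : IsSelfSimilar l s g v E) (h : k ≤ n)
    (hξ : IsCutoff ξ) (hc : 0 < c) (hα : 0 < α)
    (hEc : ∀ z, infDist z E ≤ 1 / c → ‖z‖ ^ 2 < 2 / 3) :
    ∃ C : ℝ, 0 < C ∧ ∀ (δ : ℝ) (x : EuclideanSpace ℝ (Fin n)), 0 < infDist (headPart h x) E →
      ‖truncPower h E c α δ ξ x‖ ≤
        (ball 0 1).indicator (fun x => C * infDist (headPart h x) E ^ (-(α + 1))) x ∧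
      ‖gradient (truncPower h E c α δ ξ) x‖ ≤
        (ball 0 1).indicator (fun x => C * infDist (headPart h x) E ^ (-(α + 1))) x :=
  truncPower.exists_bound hξ hc hα hEc fun _ hx => hE.infDist_headPart_lt_two h hx

/-- One constant serves all `δ`: `δ = 0` is the counterexample, `δ > 0` gives its Lipschitz
approximations. -/
theorem exists_tripleNorm_le (hE : IsSelfSimilar l s g v E) (h : k ≤ n)
    (hp : 1 < p) (hα : 0 < α) (hαp : (α + 1) * p < k - s) (hξ : IsCutoff ξ) (hc : 0 < c)
    (hEc : ∀ z, infDist z E ≤ 1 / c → ‖z‖ ^ 2 < 2 / 3) :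
    ∃ M : ℝ≥0, ∀ δ : ℝ, tripleNorm p (k - s) (ball (0 : EuclideanSpace ℝ (Fin n)) 1)
      (gradient (truncPower h E c α δ ξ)) ≤ M := by
  obtain ⟨C, hC, hbound⟩ := hE.exists_bound h hξ hc hα hEc
  obtain ⟨A, hA, hA'⟩ := hE.exists_lintegral_ball_le h (b := (α + 1) * p) (by positivity) hαp
  have hM : (ENNReal.ofReal C ^ p * A) ^ (1 / p) ≠ ⊤ :=
    ENNReal.rpow_ne_top_of_nonneg (by positivity) (ENNReal.mul_ne_top
      (ENNReal.rpow_ne_top_of_nonneg (by positivity) ENNReal.ofReal_ne_top) hA)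
  refine ⟨((ENNReal.ofReal C ^ p * A) ^ (1 / p)).toNNReal, fun δ => ?_⟩
  rw [ENNReal.coe_toNNReal hM]
  refine tripleNorm_mono_bound (by positivity)
    (G := fun x => ENNReal.ofReal C * ENNReal.ofReal (infDist (headPart h x) E) ^ (-(α + 1)))
    (fun x hx => ?_) fun y hy => ?_
  -- On the singular set the majorant is `⊤`, since `0` to a negative power is `⊤` in `ℝ≥0∞`; no
  -- null set has to be removed.
  · rcases (infDist_nonneg : 0 ≤ infDist (headPart h x) E).eq_or_lt with h0 | h0
    · rw [← h0, ENNReal.ofReal_zero, ENNReal.zero_rpow_of_neg (by linarith),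
        ENNReal.mul_top (by simpa using hC)]
      exact le_top
    · have := (hbound δ x h0).2
      rw [indicator_of_mem hx] at this
      rw [ENNReal.ofReal_rpow_of_pos h0, ← ENNReal.ofReal_mul hC.le, ← ofReal_norm]
      exact ENNReal.ofReal_le_ofReal this
  · calc _ = ENNReal.ofReal C ^ p * ∫⁻ x in ball 0 1,
          ENNReal.ofReal (infDist (headPart h x) E) ^ (-((α + 1) * p)) *
            ‖x - y‖ₑ ^ (k - s - n : ℝ) := by
          rw [← lintegral_const_mul' _ _
            (ENNReal.rpow_ne_top_of_nonneg (by positivity) ENNReal.ofReal_ne_top)]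
          refine lintegral_congr fun x => ?_
          rw [ENNReal.mul_rpow_of_nonneg _ _ (by positivity), ← ENNReal.rpow_mul, neg_mul, mul_assoc]
      _ ≤ _ := mul_le_mul_right (hA' y hy) _

theorem integrable_bound (hE : IsSelfSimilar l s g v E) (h : k ≤ n) (C : ℝ) (hα : 0 < α)
    (hαs : α + 1 < k - s) :
    Integrable ((ball (0 : EuclideanSpace ℝ (Fin n)) 1).indicator
      fun x => C * infDist (headPart h x) E ^ (-(α + 1))) := by
  rw [integrable_indicator_iff measurableSet_ball]
  refine Integrable.const_mul ⟨?_, ?_⟩ C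
  · have := (truncPower.continuous_infDist_headPart (h := h) (E := E)).measurable
    exact Measurable.aestronglyMeasurable (by fun_prop)
  · obtain ⟨A, hA, hA'⟩ := hE.exists_lintegral_ball_le h (b := α + 1) (by positivity) hαs
    refine lt_of_le_of_lt (le_trans ?_ (hA' 0 (by simp))) hA.lt_top
    refine setLIntegral_mono' measurableSet_ball fun x hx => ?_
    have hkn : (k : ℝ) ≤ n := by exact_mod_cast h
    -- For `y = 0` the kernel is at least 1 on the unit ball, so plain integrability follows from
    -- the weighted estimate.
    have h1 : 1 ≤ ‖x - 0‖ₑ ^ (k - s - n : ℝ) := by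
      have h2 : ‖x - 0‖ₑ ≤ 1 := by
        rw [mem_ball_zero_iff] at hx
        rw [sub_zero, ← ofReal_norm]
        exact ENNReal.ofReal_le_one.2 hx.le
      have h3 := ENNReal.rpow_neg_le_rpow_neg h2 (t := n - (k - s))
        (by linarith [hE.dim_nonneg])
      rwa [ENNReal.one_rpow, neg_sub] at h3
    refine le_trans ?_ (le_mul_of_one_le_right' h1)
    rcases (infDist_nonneg : 0 ≤ infDist (headPart h x) E).eq_or_lt with h0 | h0
    · rw [← h0, ENNReal.ofReal_zero, ENNReal.zero_rpow_of_neg (by linarith)]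
      exact le_top
    · rw [ENNReal.ofReal_rpow_of_pos h0, ← ofReal_norm, Real.norm_of_nonneg (by positivity)]

theorem ae_differentiableAt (hE : IsSelfSimilar l s g v E) (hs : s < k) (h : k ≤ n)
    (hξ : IsCutoff ξ) (hc : 0 < c) (hα : 0 < α) :
    ∀ᵐ x, DifferentiableAt ℝ (truncPower h E c α 0 ξ) x := by
  have h1 : ∀ᵐ x, ∀ j : ℕ, DifferentiableAt ℝ (truncPower h E c α (1 / ((j : ℝ) + 1)) ξ) x := by
    refine ae_all_iff.2 fun j => ?_
    obtain ⟨K, hK⟩ := truncPower.exists_lipschitzWith (h := h) (E := E) hξ hc.le hα.le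
      (δ := 1 / ((j : ℝ) + 1)) (by positivity)
    exact hK.ae_differentiableAt
  filter_upwards [h1, hE.ae_infDist_headPart_pos hs h] with x hx hx0
  obtain ⟨j, hj⟩ := (truncPower.eventually_eventuallyEq (c := c) (α := α) (ξ := ξ) hx0).exists
  exact hj.differentiableAt_iff.1 (hx j)

/-- The formula holds for the Lipschitz truncations and passes to the limit by dominated
convergence; a multiple of d^(-(α+1)) on the unit ball, integrable as α + 1 < k − s, dominates
functions and gradients alike. -/
theorem hasWeakGradient (hE : IsSelfSimilar l s g v E) (h : k ≤ n)
    (hα : 0 < α) (hαs : α + 1 < k - s) (hξ : IsCutoff ξ) (hc : 0 < c)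
    (hEc : ∀ z, infDist z E ≤ 1 / c → ‖z‖ ^ 2 < 2 / 3) :
    HasWeakGradient (truncPower h E c α 0 ξ) (gradient (truncPower h E c α 0 ξ)) := by
  obtain ⟨C, hC, hbound⟩ := hE.exists_bound h hξ hc hα hEc
  have hint := hE.integrable_bound h C hα hαs
  have hpos := hE.ae_infDist_headPart_pos (by linarith) h
  set B := (ball (0 : EuclideanSpace ℝ (Fin n)) 1).indicator
      fun x => C * infDist (headPart h x) E ^ (-(α + 1))
  refine ⟨Integrable.locallyIntegrable ?_, Integrable.locallyIntegrable ?_, fun φ hφ hsupp i => ?_⟩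
  · refine hint.mono' (truncPower.measurable hξ).aestronglyMeasurable ?_
    filter_upwards [hpos] with x hx using (hbound 0 x hx).1
  · refine hint.mono' (measurable_gradient _).aestronglyMeasurable ?_
    filter_upwards [hpos] with x hx using (hbound 0 x hx).2
  · set u : ℕ → EuclideanSpace ℝ (Fin n) → ℝ := fun j => truncPower h E c α (1 / ((j : ℝ) + 1)) ξ
    have hu : ∀ j, ∫ x, u j x * fderiv ℝ φ x (EuclideanSpace.single i 1) =
        -∫ x, gradient (u j) x i * φ x := by
      intro j
      obtain ⟨K, hK⟩ := truncPower.exists_lipschitzWith (h := h) (E := E) hξ hc.le hα.le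
        (δ := 1 / ((j : ℝ) + 1)) (by positivity)
      exact hK.integral_mul_fderiv_eq hφ hsupp i
    have hφ' : Continuous fun x => fderiv ℝ φ x (EuclideanSpace.single i 1) :=
      (hφ.continuous_fderiv (by simp)).clm_apply continuous_const
    obtain ⟨D, hD⟩ := hsupp.exists_bound_of_continuous hφ.continuous
    obtain ⟨D', hD'⟩ := (hsupp.fderiv_apply ℝ (EuclideanSpace.single i 1)).exists_bound_of_continuous
      hφ'
    have hlim1 : Filter.Tendsto (fun j => ∫ x, u j x * fderiv ℝ φ x (EuclideanSpace.single i 1))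
        Filter.atTop (nhds (∫ x, truncPower h E c α 0 ξ x *
          fderiv ℝ φ x (EuclideanSpace.single i 1))) := by
      refine tendsto_integral_of_dominated_convergence (fun x => B x * D') (fun j => ?_)
        (hint.mul_const D') (fun j => ?_) ?_
      · exact ((truncPower.measurable hξ).mul hφ'.measurable).aestronglyMeasurable
      · filter_upwards [hpos] with x hx
        rw [norm_mul]
        exact mul_le_mul (hbound _ x hx).1 (hD' x) (norm_nonneg _)
          ((norm_nonneg _).trans (hbound 0 x hx).1)
      · filter_upwards [hpos] with x hx
        refine Filter.Tendsto.congr' ?_ tendsto_const_nhds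
        filter_upwards [truncPower.eventually_eventuallyEq (c := c) (α := α) (ξ := ξ) hx] with j hj
        simp only [u, hj.eq_of_nhds]
    have hlim2 : Filter.Tendsto (fun j => ∫ x, gradient (u j) x i * φ x)
        Filter.atTop (nhds (∫ x, gradient (truncPower h E c α 0 ξ) x i * φ x)) := by
      refine tendsto_integral_of_dominated_convergence (fun x => B x * D) (fun j => ?_)
        (hint.mul_const D) (fun j => ?_) ?_
      · have h1 := measurable_gradient (u j)
        have h2 := hφ.continuous.measurable
        refine Measurable.aestronglyMeasurable (Measurable.mul ?_ h2)
        exact (EuclideanSpace.proj (𝕜 := ℝ) i).continuous.measurable.comp h1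
      · filter_upwards [hpos] with x hx
        rw [norm_mul]
        exact mul_le_mul ((PiLp.norm_apply_le _ i).trans (hbound _ x hx).2) (hD x) (norm_nonneg _)
          ((norm_nonneg _).trans (hbound 0 x hx).1)
      · filter_upwards [hpos] with x hx
        refine Filter.Tendsto.congr' ?_ tendsto_const_nhds
        filter_upwards [truncPower.eventually_eventuallyEq (c := c) (α := α) (ξ := ξ) hx] with j hj
        simp only [u, hj.gradient_eq]
    refine tendsto_nhds_unique hlim1 ?_
    simp_rw [hu]
    exact hlim2.neg

theorem eLpNorm_truncPower (hE : IsSelfSimilar l s g v E) (hs : s < k) (h : k ≤ n)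
    (hα : 0 < α) (hq : 0 < q) (hαq : k - s ≤ α * q) (hξ : IsCutoff ξ) (hc : 1 ≤ c)
    (hEc : ∀ z, infDist z E ≤ 1 / c → ‖z‖ ^ 2 < 2 / 3) :
    eLpNorm (truncPower h E c α 0 ξ) (ENNReal.ofReal q)
      (volume.restrict (ball (0 : EuclideanSpace ℝ (Fin n)) 1)) = ⊤ := by
  have hc0 : 0 < c := by linarith
  rw [eLpNorm_eq_lintegral_rpow_enorm_toReal (by simpa using hq) ENNReal.ofReal_ne_top,
    ENNReal.toReal_ofReal hq.le]
  refine ENNReal.rpow_eq_top_iff_of_pos (by positivity) |>.2 (top_unique ?_)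
  -- Chosen so that `r ^ (-α) = 2 * c ^ α`: at distances below `r`, subtracting `c ^ α` costs at
  -- most half of the power.
  set r : ℝ := (2 * c ^ α) ^ (-α⁻¹)
  have hr : 0 < r := by positivity
  have hcα : 1 ≤ c ^ α := Real.one_le_rpow hc hα.le
  have hr1 : r ≤ 1 := Real.rpow_le_one_of_one_le_of_nonpos (by linarith) (by simpa using hα.le)
  have key : ∀ t : ℝ, 0 < t → t < r → 1 / 2 * t ^ (-α) ≤ t ^ (-α) - c ^ α := by
    intro t ht htr
    have h1 : r ^ (-α) ≤ t ^ (-α) := Real.rpow_le_rpow_of_nonpos ht htr.le (by linarith)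
    have h2 : r ^ (-α) = 2 * c ^ α := by
      rw [← Real.rpow_mul (by positivity), neg_mul_neg, inv_mul_cancel₀ hα.ne', Real.rpow_one]
    linarith
  set S : Set (EuclideanSpace ℝ (Fin k)) := {z | 0 < infDist z E ∧ infDist z E < r}
  have hval : ∀ x : EuclideanSpace ℝ (Fin n), headPart h x ∈ S → tailPart h x ∈ ball 0 (1 / 2) →
      1 / 2 * infDist (headPart h x) E ^ (-α) ≤ truncPower h E c α 0 ξ x := by
    intro x hx hx'
    rw [mem_ball_zero_iff] at hx'
    unfold truncPower
    rw [hξ.eq_one _ (norm_nonneg _) hx', mul_one, max_eq_left hx.1.le]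
    exact (key _ hx.1 hx.2).trans (le_max_left _ _)
  -- The function is positive on this set and vanishes off the unit ball, which gives the inclusion
  -- without any geometry.
  have hsub : {x : EuclideanSpace ℝ (Fin n) | headPart h x ∈ S ∧ tailPart h x ∈ ball 0 (1 / 2)} ⊆
      ball 0 1 := by
    intro x hx
    by_contra hxb
    have h1 := hval x hx.1 hx.2
    rw [truncPower.eq_zero hξ hc0 hα hEc hxb] at h1
    have h2 : 0 < infDist (headPart h x) E := hx.1.1
    have h3 : 0 < 1 / 2 * infDist (headPart h x) E ^ (-α) := by positivity
    linarith
  have hS : MeasurableSet S := (isOpen_layer E 0 r).measurableSet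
  calc (⊤ : ℝ≥0∞) = ENNReal.ofReal (1 / 2) ^ q *
        ((∫⁻ z in S, ENNReal.ofReal (infDist z E) ^ (-((k : ℝ) - s))) *
          ∫⁻ w in ball (0 : EuclideanSpace ℝ (Fin (n - k))) (1 / 2), 1) := by
        have h1 := hE.lintegral_eq_top volume (by simpa using hs) hr
        rw [finrank_euclideanSpace_fin] at h1
        rw [h1, setLIntegral_const, one_mul, ENNReal.top_mul
          (measure_ball_pos _ _ (by norm_num)).ne', ENNReal.mul_top]
        simp
    _ = ∫⁻ x in {x : EuclideanSpace ℝ (Fin n) |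
          headPart h x ∈ S ∧ tailPart h x ∈ ball 0 (1 / 2)}, ENNReal.ofReal (1 / 2) ^ q *
            (ENNReal.ofReal (infDist (headPart h x) E) ^ (-((k : ℝ) - s)) * 1) := by
        rw [lintegral_const_mul' _ _ (ENNReal.rpow_ne_top_of_nonneg hq.le ENNReal.ofReal_ne_top),
          ← lintegral_headPart_mul_tailPart h hS measurableSet_ball _ measurable_const]
        have := (continuous_infDist_pt E).measurable
        fun_prop
    _ ≤ ∫⁻ x in {x : EuclideanSpace ℝ (Fin n) |
          headPart h x ∈ S ∧ tailPart h x ∈ ball 0 (1 / 2)}, ‖truncPower h E c α 0 ξ x‖ₑ ^ q := by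
        have hm := ((measurePreserving_split h).measurable (hS.prod
          (measurableSet_ball (x := (0 : EuclideanSpace ℝ (Fin (n - k)))) (ε := 1 / 2))))
        refine setLIntegral_mono' hm fun x hx => ?_
        have h0 : 0 < infDist (headPart h x) E := hx.1.1
        have h1 := hval x hx.1 hx.2
        have h2 : ENNReal.ofReal (1 / 2 * infDist (headPart h x) E ^ (-α)) ≤
            ‖truncPower h E c α 0 ξ x‖ₑ := by
          rw [← ofReal_norm]
          exact ENNReal.ofReal_le_ofReal (h1.trans (Real.le_norm_self _))
        refine le_trans ?_ (ENNReal.rpow_le_rpow h2 hq.le)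
        rw [ENNReal.ofReal_mul (by norm_num), ENNReal.mul_rpow_of_nonneg _ _ hq.le, mul_one,
          ← ENNReal.ofReal_rpow_of_pos h0, ← ENNReal.rpow_mul]
        -- Here the distance is at most `r ≤ 1`, so `k - s ≤ α * q` makes the power `-α * q` at
        -- least the critical one.
        refine mul_le_mul_right (ENNReal.rpow_le_rpow_of_exponent_ge ?_ (by linarith)) _
        rw [ENNReal.ofReal_le_one]
        exact hx.1.2.le.trans hr1
    _ ≤ _ := lintegral_mono_set hsub

/-- The truncated functions are not bounded in `L^q`. -/
theorem not_eLpNorm_le (hE : IsSelfSimilar l s g v E) (hs : s < k) (h : k ≤ n)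
    (hα : 0 < α) (hq : 0 < q) (hαq : k - s ≤ α * q) (hξ : IsCutoff ξ) (hc : 1 ≤ c)
    (hEc : ∀ z, infDist z E ≤ 1 / c → ‖z‖ ^ 2 < 2 / 3) (M : ℝ≥0) :
    ∃ j : ℕ, M < eLpNorm (truncPower h E c α (1 / ((j : ℝ) + 1)) ξ) (ENNReal.ofReal q)
      (volume.restrict (ball (0 : EuclideanSpace ℝ (Fin n)) 1)) := by
  by_contra! hM
  -- Fatou's lemma: a common bound for the truncations would bound their limit, whose norm is
  -- infinite.
  have h1 := Lp.eLpNorm_lim_le_liminf_eLpNorm (p := ENNReal.ofReal q)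
    (μ := volume.restrict (ball (0 : EuclideanSpace ℝ (Fin n)) 1))
    (f := fun j : ℕ => truncPower h E c α (1 / ((j : ℝ) + 1)) ξ)
    (fun j => (truncPower.measurable hξ).aestronglyMeasurable) (truncPower h E c α 0 ξ) (by
      refine ae_restrict_of_ae ?_
      filter_upwards [hE.ae_infDist_headPart_pos hs h] with x hx
      refine Filter.Tendsto.congr' ?_ tendsto_const_nhds
      filter_upwards [truncPower.eventually_eventuallyEq (c := c) (α := α) (ξ := ξ) hx] with j hj
      rw [hj.eq_of_nhds])
  rw [hE.eLpNorm_truncPower hs h hα hq hαq hξ hc hEc] at h1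
  have h2 := h1.trans (Filter.liminf_le_of_le (a := (M : ℝ≥0∞)) (by isBoundedDefault) fun b hb => by
    obtain ⟨j, hj⟩ := hb.exists
    exact hj.trans (hM j))
  exact ENNReal.coe_ne_top (top_unique h2)

theorem isCounterexample (hE : IsSelfSimilar l s g v E) (h : k ≤ n) (hp : 1 < p)
    (hq : 0 < q) (hα : 0 < α) (hαp : (α + 1) * p < k - s)
    (hαq : k - s ≤ α * q) (hξ : IsCutoff ξ) (hc : 1 ≤ c)
    (hEc : ∀ z, infDist z E ≤ 1 / c → ‖z‖ ^ 2 < 2 / 3) :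
    IsCounterexample p (k - s) q (truncPower h E c α 0 ξ) := by
  have hα1 : α + 1 < k - s := by nlinarith
  have hs : s < k := by linarith
  have hc0 : 0 < c := by linarith
  have htriple : tripleNorm p (k - s) (ball 0 1) (gradient (truncPower h E c α 0 ξ)) < ⊤ := by
    obtain ⟨M, hM⟩ := hE.exists_tripleNorm_le h hp hα hαp hξ hc0 hEc
    exact (hM 0).trans_lt ENNReal.coe_lt_top
  have hkn : (k : ℝ) ≤ n := by exact_mod_cast h
  exact {
    eq_zero := fun x hx => truncPower.eq_zero hξ hc0 hα hEc hx
    ae_differentiable := hE.ae_differentiableAt hs h hξ hc0 hα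
    weak_gradient := hE.hasWeakGradient h hα hα1 hξ hc0 hEc
    eLpNorm_eq_top := hE.eLpNorm_truncPower hs h hα hq hαq hξ hc hEc
    tripleNorm_lt_top := htriple
    morreyNorm_lt_top := (morreyNorm_le_tripleNorm (by positivity)
      (by linarith [hE.dim_nonneg]) measurableSet_ball _).trans_lt htriple }

/-- There are Lipschitz functions with bounded triple norms of the gradients and with arbitrarily
large norms in `L^q`. -/
theorem exists_lipschitzWith_lt_eLpNorm (hE : IsSelfSimilar l s g v E) (h : k ≤ n) (hp : 1 < p)
    (hq : 0 < q) (hα : 0 < α) (hαp : (α + 1) * p < k - s)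
    (hαq : k - s ≤ α * q) (hξ : IsCutoff ξ) (hc : 1 ≤ c)
    (hEc : ∀ z, infDist z E ≤ 1 / c → ‖z‖ ^ 2 < 2 / 3) (C : ℝ≥0) :
    ∃ u : EuclideanSpace ℝ (Fin n) → ℝ, (∃ K : ℝ≥0, LipschitzWith K u) ∧
      (∀ x ∉ ball (0 : EuclideanSpace ℝ (Fin n)) 1, u x = 0) ∧
      C * tripleNorm p (k - s) (ball 0 1) (gradient u) <
        eLpNorm u (ENNReal.ofReal q) (volume.restrict (ball 0 1)) := by
  have hα1 : α + 1 < k - s := by nlinarith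
  have hc0 : 0 < c := by linarith
  obtain ⟨M, hM⟩ := hE.exists_tripleNorm_le h hp hα hαp hξ hc0 hEc
  obtain ⟨j, hj⟩ := hE.not_eLpNorm_le (by linarith) h hα hq hαq hξ hc hEc (C * M)
  refine ⟨_, truncPower.exists_lipschitzWith hξ hc0.le hα.le (δ := 1 / ((j : ℝ) + 1))
    (by positivity), fun x hx => truncPower.eq_zero hξ hc0 hα hEc hx, lt_of_le_of_lt ?_ hj⟩
  rw [ENNReal.coe_mul]
  exact mul_le_mul_right (hM _) _

end IsSelfSimilar

/-! ### Hausdorff dimension of self-similar sets -/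

namespace IsSelfSimilar

variable {X Y ι : Type*} [NormedAddCommGroup X] [NormedSpace ℝ X] [NormedAddCommGroup Y]
  [NormedSpace ℝ Y] [Fintype ι] {l s g : ℝ} {v : ι → X} {E : Set X}

theorem image (h : IsSelfSimilar l s g v E) (L : X →ₗᵢ[ℝ] Y) :
    IsSelfSimilar l s g (fun i => L (v i)) (L '' E) where
  nonempty := h.nonempty.image _
  subset := by
    rintro _ ⟨x, hx, rfl⟩
    have := h.subset hx
    rw [mem_closedBall_zero_iff] at this ⊢
    rwa [L.norm_map]
  pos := h.pos
  lt_one := h.lt_one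
  dim_nonneg := h.dim_nonneg
  card_mul := h.card_mul
  gap_pos := h.gap_pos
  maps := by
    rintro i _ ⟨x, hx, rfl⟩
    exact ⟨l • x + v i, h.maps i x hx, by simp⟩
  cover := by
    rintro _ ⟨x, hx, rfl⟩
    obtain ⟨i, y, hy, rfl⟩ := h.cover x hx
    exact ⟨i, L y, ⟨y, hy, rfl⟩, by simp⟩
  gap := by
    rintro i j hij _ ⟨x, hx, rfl⟩ _ ⟨y, hy, rfl⟩
    rw [← map_smul, ← map_smul, ← map_add, ← map_add, L.isometry.dist_eq]
    exact h.gap i j hij x hx y hy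

/-- The image of `E` under the composition of the similarities with indices `w 0, w 1, …`. -/
def piece (l : ℝ) (v : ι → X) (E : Set X) : (m : ℕ) → (Fin m → ι) → Set X
  | 0, _ => E
  | m + 1, w => (fun x => l • x + v (w 0)) '' piece l v E m (Fin.tail w)

theorem subset_iUnion_piece (h : IsSelfSimilar l s g v E) (m : ℕ) :
    E ⊆ ⋃ w, piece l v E m w := by
  induction m with
  | zero => exact fun x hx => mem_iUnion.2 ⟨Fin.elim0, hx⟩
  | succ m ih =>
    intro x hx
    obtain ⟨i, y, hy, rfl⟩ := h.cover x hx
    obtain ⟨w, hw⟩ := mem_iUnion.1 (ih hy)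
    exact mem_iUnion.2 ⟨Fin.cons i w, y, by simpa using hw, by simp⟩

theorem ediam_piece_le (h : IsSelfSimilar l s g v E) (m : ℕ) (w : Fin m → ι) :
    ediam (piece l v E m w) ≤ ENNReal.ofReal l ^ m := by
  induction m with
  | zero =>
    rw [pow_zero]
    refine (ediam_mono h.subset).trans (ediam_le fun x hx y hy => ?_)
    rw [mem_closedBall] at hx hy
    rw [edist_dist, ENNReal.ofReal_le_one]
    linarith [dist_triangle_right x y 0]
  | succ m ih =>
    have hlip : LipschitzWith (Real.toNNReal l) (fun x => l • x + v (w 0)) :=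
      LipschitzWith.of_dist_le_mul fun x y => by
        rw [h.dist_map, Real.coe_toNNReal _ h.pos.le]
    rw [pow_succ']
    exact (hlip.ediam_image_le _).trans (mul_le_mul_right (ih _) _)

/-- The `N ^ m` pieces of generation `m` have diameter at most `l ^ m`, and `N ^ m * (l ^ m) ^ s =
1`, so the `s`-dimensional Hausdorff measure is at most 1. -/
theorem dimH_le (h : IsSelfSimilar l s g v E) : dimH E ≤ ENNReal.ofReal s := by
  borelize X
  have h1 : ENNReal.ofReal l < 1 := by simpa using h.lt_one
  have h2 := Measure.hausdorffMeasure_le_liminf_sum s E (fun m : ℕ => ENNReal.ofReal l ^ m)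
    (ENNReal.tendsto_pow_atTop_nhds_zero_of_lt_one h1) (fun m w => piece l v E m w)
    (Filter.Eventually.of_forall fun m w => h.ediam_piece_le m w)
    (Filter.Eventually.of_forall fun m => h.subset_iUnion_piece m)
  have h3 : ∀ m : ℕ, ∑ w : Fin m → ι, ediam (piece l v E m w) ^ s ≤ 1 := by
    intro m
    calc _ ≤ ∑ w : Fin m → ι, (ENNReal.ofReal l ^ m) ^ s :=
          Finset.sum_le_sum fun w _ => ENNReal.rpow_le_rpow (h.ediam_piece_le m w) h.dim_nonneg
      _ = ((Fintype.card ι : ℝ≥0∞) * ENNReal.ofReal l ^ s) ^ m := by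
          rw [Finset.sum_const, nsmul_eq_mul, Finset.card_univ, Fintype.card_fun, Fintype.card_fin,
            mul_pow, ← ENNReal.rpow_natCast, ← ENNReal.rpow_mul, mul_comm (m : ℝ), ENNReal.rpow_mul,
            ENNReal.rpow_natCast]
          push_cast
          rfl
      _ = 1 := by rw [h.card_mul_ennreal, one_pow]
  have h4 : Measure.hausdorffMeasure s E ≤ 1 := h2.trans
    (Filter.liminf_le_of_le (by isBoundedDefault) fun b hb => by
      obtain ⟨m, hm⟩ := hb.exists
      exact hm.trans (h3 m))
  exact dimH_le_of_hausdorffMeasure_ne_top (d := s.toNNReal)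
    (by rw [Real.coe_toNNReal _ h.dim_nonneg]; exact (h4.trans_lt ENNReal.one_lt_top).ne)

/-- A self-similar set in which every sequence of indices is realized by a point has the full
dimension `s`. -/
theorem le_dimH {N : ℕ} (hN : 1 < N) {v : Fin N → X} (h : IsSelfSimilar l s g v E) (hs : 0 < s)
    (π : (ℕ → Fin N) → X) (hπ : ∀ a, π a ∈ E)
    (hπ_eq : ∀ a, π a = l • π (fun i => a (i + 1)) + v (a 0)) :
    ENNReal.ofReal s ≤ dimH E := by
  have hl := h.pos
  have hg := h.gap_pos
  -- Undoing the `m` common similarities moves the two points into different first-generation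
  -- pieces.
  have hgap : ∀ (m : ℕ) (a b : ℕ → Fin N), (∀ i < m, a i = b i) → a m ≠ b m →
      g * l ^ m ≤ dist (π a) (π b) := by
    intro m
    induction m with
    | zero =>
      intro a b _ hab
      rw [hπ_eq a, hπ_eq b, pow_zero, mul_one]
      exact h.gap _ _ hab _ (hπ _) _ (hπ _)
    | succ m ih =>
      intro a b hab hne
      have h1 := ih (fun i => a (i + 1)) (fun i => b (i + 1)) (fun i hi => hab _ (by omega)) hne
      rw [hπ_eq a, hπ_eq b, hab 0 (by omega), h.dist_map, pow_succ]
      have := mul_le_mul_of_nonneg_left h1 hl.le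
      linarith
  have hfirst : ∀ a b : ℕ → Fin N, a ≠ b → ∃ m, (∀ i < m, a i = b i) ∧ a m ≠ b m := by
    intro a b hab
    classical
    have hex : ∃ m, a m ≠ b m := Function.ne_iff.1 hab
    exact ⟨Nat.find hex, fun i hi => not_not.1 (Nat.find_min hex hi), Nat.find_spec hex⟩
  have hinj : Function.Injective π := by
    intro a b hab
    by_contra hne
    obtain ⟨m, h1, h2⟩ := hfirst a b hne
    have := hgap m a b h1 h2
    rw [hab, dist_self] at this
    have : 0 < g * l ^ m := by positivity
    linarith
  have hcard : ∀ m : ℕ, (l ^ m) ^ s = ((N : ℝ) ^ m)⁻¹ := by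
    intro m
    have h1 := h.card_mul
    rw [Fintype.card_fin] at h1
    rw [← Real.rpow_natCast, ← Real.rpow_mul hl.le, mul_comm, Real.rpow_mul hl.le,
      Real.rpow_natCast, ← inv_pow, eq_inv_of_mul_eq_one_right h1]
  have : Nonempty (ℕ → Fin N) := ⟨fun _ => ⟨0, by omega⟩⟩
  -- Read the address as a base `N` expansion. Addresses agreeing up to `m` give values within `N ^
  -- (-m) = (l ^ m) ^ s`, so the gap estimate makes `f` Hölder of exponent `s`, while its image
  -- contains [0,1].
  set f : X → ℝ := fun x => Real.ofDigits (Function.invFun π x)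
  have hf : ∀ a, f (π a) = Real.ofDigits a := fun a => by
    simp only [f, Function.leftInverse_invFun hinj a]
  have hhol : HolderOnWith (Real.toNNReal (g ^ (-s))) s.toNNReal f (range π) := by
    rintro _ ⟨a, rfl⟩ _ ⟨b, rfl⟩
    rw [hf, hf, edist_dist, edist_dist, Real.coe_toNNReal _ hs.le,
      ENNReal.ofReal_rpow_of_nonneg dist_nonneg hs.le, ← ENNReal.ofReal,
      ← ENNReal.ofReal_mul (by positivity)]
    refine ENNReal.ofReal_le_ofReal ?_
    by_cases hab : a = b
    · rw [hab, dist_self]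
      positivity
    · obtain ⟨m, h1, h2⟩ := hfirst a b hab
      have h3 := Real.rpow_le_rpow (by positivity) (hgap m a b h1 h2) hs.le
      rw [Real.mul_rpow hg.le (by positivity), hcard] at h3
      rw [Real.rpow_neg hg.le, Real.dist_eq, inv_mul_eq_div, le_div_iff₀' (by positivity)]
      exact (mul_le_mul_of_nonneg_left (Real.abs_ofDigits_sub_ofDigits_le h1) (by positivity)).trans
        h3
  have h1 := hhol.dimH_image_le (by simpa using hs)
  have h2 : Icc (0 : ℝ) 1 ⊆ f '' range π := by
    intro t ht
    obtain ⟨a, -, rfl⟩ := Real.ofDigits_SurjOn hN ht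
    exact ⟨π a, ⟨a, rfl⟩, hf a⟩
  have h3 : dimH (Icc (0 : ℝ) 1) = 1 := by
    rw [Real.dimH_of_nonempty_interior (by simp)]
    simp
  have h4 : (1 : ℝ≥0∞) ≤ dimH E / ENNReal.ofReal s := by
    rw [← h3]
    refine (dimH_mono h2).trans (h1.trans ?_)
    exact ENNReal.div_le_div_right (dimH_mono (range_subset_iff.2 hπ)) _
  rwa [ENNReal.le_div_iff_mul_le (Or.inl (by simpa using hs)) (Or.inl ENNReal.ofReal_ne_top),
    one_mul] at h4

end IsSelfSimilar

/-! ### The generalized Cantor set, parametrized by its contraction ratio l, with γ = 1 − 2l -/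

/-- The translations of the two similarities `t ↦ l * t ± (1 - l) / 2`. -/
noncomputable def cantorShift (l : ℝ) (i : Fin 2) : ℝ := if i = 0 then -((1 - l) / 2) else (1 - l) / 2

section Cantor

variable {l : ℝ}

theorem cantorLength_eq (l : ℝ) (j : ℕ) : cantorLength (1 - 2 * l) j = l ^ j := by
  unfold cantorLength
  congr 1
  ring

/-- The definition subdivides the smallest segments; here the same points arise by applying the two
large-scale contractions to the previous generation. Exchanging the two ends of the recursion is the
source of self-similarity. -/
theorem mem_cantorMidpoints_succ (j : ℕ) (t : ℝ) :
    t ∈ cantorMidpoints (1 - 2 * l) (j + 1) ↔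
      ∃ i, ∃ c ∈ cantorMidpoints (1 - 2 * l) j, t = l * c + cantorShift l i := by
  have h1 : (1 + (1 - 2 * l)) / 4 = (1 - l) / 2 := by ring
  induction j generalizing t with
  | zero =>
    simp only [cantorMidpoints, mem_ofPred_eq, mem_singleton_iff, exists_eq_left, cantorLength_eq, h1,
      cantorShift, Fin.exists_fin_two]
    simp
  | succ j ih =>
    rw [cantorMidpoints]
    simp only [mem_ofPred_eq, cantorLength_eq, h1]
    constructor
    · rintro ⟨c, hc, ht⟩
      obtain ⟨i, c', hc', rfl⟩ := (ih c).1 hc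
      rcases ht with rfl | rfl
      · exact ⟨i, c' - (1 - l) / 2 * l ^ j, ⟨c', hc', Or.inl (by rw [h1, cantorLength_eq])⟩, by ring⟩
      · exact ⟨i, c' + (1 - l) / 2 * l ^ j, ⟨c', hc', Or.inr (by rw [h1, cantorLength_eq])⟩, by ring⟩
    · rintro ⟨i, c, ⟨c', hc', hc⟩, rfl⟩
      rw [h1, cantorLength_eq] at hc
      refine ⟨l * c' + cantorShift l i, (ih _).2 ⟨i, c', hc', rfl⟩, ?_⟩
      rcases hc with rfl | rfl
      · left; ring
      · right; ring

theorem mem_genCantorSet_iff (t : ℝ) : t ∈ genCantorSet (1 - 2 * l) ↔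
    |t| ≤ 1 / 2 ∧ ∀ j, ∀ c ∈ cantorMidpoints (1 - 2 * l) j, (1 - 2 * l) * l ^ j / 2 ≤ |t - c| := by
  simp only [genCantorSet, mem_sdiff, mem_Icc, mem_iUnion, mem_Ioo, cantorLength_eq, not_exists,
    abs_le, neg_div]
  refine and_congr_right fun _ => forall_congr' fun j => forall_congr' fun c => forall_congr' fun _ => ?_
  rw [not_and_or, not_lt, not_lt, le_abs]
  constructor <;> rintro (h | h) <;> [right; left; right; left] <;> linarith

theorem abs_cantorMap_le (h0 : 0 < l) (h1 : l < 1 / 2) {t : ℝ} (ht : |t| ≤ 1 / 2) (i : Fin 2) :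
    |l * t + cantorShift l i| ≤ 1 / 2 := by
  rw [abs_le] at ht ⊢
  unfold cantorShift
  split_ifs <;> constructor <;> nlinarith

/-- The two images lie in the end segments of length `l`, which the first removed interval, of
length `1 - 2 * l`, separates. -/
theorem le_abs_cantorMap_sub_cantorMap (h0 : 0 < l) {t c : ℝ} (ht : |t| ≤ 1 / 2) (hc : |c| ≤ 1 / 2)
    {i i' : Fin 2} (hi : i ≠ i') :
    1 - 2 * l ≤ |(l * t + cantorShift l i) - (l * c + cantorShift l i')| := by
  rw [abs_le] at ht hc
  rw [le_abs]
  unfold cantorShift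
  have : (i = 0 ∧ i' = 1) ∨ (i = 1 ∧ i' = 0) := by omega
  rcases this with ⟨rfl, rfl⟩ | ⟨rfl, rfl⟩
  · right; simp; nlinarith
  · left; simp; nlinarith

theorem abs_cantorMidpoint_le (h0 : 0 < l) (h1 : l < 1 / 2) (j : ℕ) :
    ∀ c ∈ cantorMidpoints (1 - 2 * l) j, |c| ≤ 1 / 2 - l ^ j / 2 := by
  induction j with
  | zero => simp [cantorMidpoints]
  | succ j ih =>
    intro c hc
    obtain ⟨i, c', hc', rfl⟩ := (mem_cantorMidpoints_succ j c).1 hc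
    have := ih c' hc'
    rw [abs_le] at this ⊢
    rw [pow_succ']
    unfold cantorShift
    split_ifs <;> constructor <;> nlinarith

/-- If `t` avoids the intervals removed in step `j`, its image avoids those removed in step
`j + 1`. -/
theorem le_abs_cantorMap_sub (h0 : 0 < l) (h1 : l < 1 / 2) {t : ℝ} (ht : |t| ≤ 1 / 2) {j : ℕ}
    (hj : ∀ c ∈ cantorMidpoints (1 - 2 * l) j, (1 - 2 * l) * l ^ j / 2 ≤ |t - c|) (i : Fin 2) :
    ∀ c ∈ cantorMidpoints (1 - 2 * l) (j + 1),
      (1 - 2 * l) * l ^ (j + 1) / 2 ≤ |(l * t + cantorShift l i) - c| := by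
  intro c hc
  obtain ⟨i', c', hc', rfl⟩ := (mem_cantorMidpoints_succ j c).1 hc
  by_cases hi : i = i'
  · subst hi
    rw [add_sub_add_right_eq_sub, ← mul_sub, abs_mul, abs_of_pos h0, pow_succ']
    have := mul_le_mul_of_nonneg_left (hj c' hc') h0.le
    linarith
  · have h2 := abs_cantorMidpoint_le h0 h1 j c' hc'
    have h3 : 0 < l ^ j := by positivity
    refine le_trans ?_ (le_abs_cantorMap_sub_cantorMap h0 ht (by linarith) hi)
    have h4 : l ^ (j + 1) ≤ 1 := pow_le_one₀ h0.le (by linarith)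
    nlinarith

theorem le_abs_cantorMap (h0 : 0 < l) {t : ℝ} (ht : |t| ≤ 1 / 2) (i : Fin 2) :
    ∀ c ∈ cantorMidpoints (1 - 2 * l) 0,
      (1 - 2 * l) * l ^ 0 / 2 ≤ |(l * t + cantorShift l i) - c| := by
  intro c hc
  rw [cantorMidpoints, mem_singleton_iff] at hc
  rw [hc, sub_zero, le_abs, pow_zero]
  rw [abs_le] at ht
  unfold cantorShift
  split_ifs
  · right; nlinarith
  · left; nlinarith

theorem genCantorSet_maps (h0 : 0 < l) (h1 : l < 1 / 2) {t : ℝ}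
    (ht : t ∈ genCantorSet (1 - 2 * l)) (i : Fin 2) :
    l * t + cantorShift l i ∈ genCantorSet (1 - 2 * l) := by
  rw [mem_genCantorSet_iff] at ht ⊢
  refine ⟨abs_cantorMap_le h0 h1 ht.1 i, fun j => ?_⟩
  cases j with
  | zero => exact le_abs_cantorMap h0 ht.1 i
  | succ j => exact le_abs_cantorMap_sub h0 h1 ht.1 (ht.2 j) i

/-- A point outside the first removed interval lies in an end segment. Magnified by `1 / l`, it
avoids the intervals of step `j` because it avoided those of step `j + 1`. -/
theorem genCantorSet_cover (h0 : 0 < l) {t : ℝ}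
    (ht : t ∈ genCantorSet (1 - 2 * l)) :
    ∃ i, ∃ t' ∈ genCantorSet (1 - 2 * l), t = l * t' + cantorShift l i := by
  rw [mem_genCantorSet_iff] at ht
  obtain ⟨ht1, ht2⟩ := ht
  have h2 := ht2 0 0 (by simp [cantorMidpoints])
  rw [sub_zero, pow_zero, mul_one] at h2
  obtain ⟨i, hi⟩ : ∃ i, |t - cantorShift l i| ≤ l / 2 := by
    rw [le_abs] at h2
    rw [abs_le] at ht1
    rcases h2 with h2 | h2
    · refine ⟨1, ?_⟩
      rw [abs_le]
      simp only [cantorShift, one_ne_zero, if_false]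
      constructor <;> linarith
    · refine ⟨0, ?_⟩
      rw [abs_le]
      simp only [cantorShift, if_true]
      constructor <;> linarith
  have hmap : t = l * ((t - cantorShift l i) / l) + cantorShift l i := by
    field_simp
    ring
  refine ⟨i, (t - cantorShift l i) / l, (mem_genCantorSet_iff _).2 ⟨?_, fun j c hc => ?_⟩, hmap⟩
  · rw [abs_div, abs_of_pos h0, div_le_iff₀ h0]
    linarith
  · have h3 := ht2 (j + 1) _ ((mem_cantorMidpoints_succ j _).2 ⟨i, c, hc, rfl⟩)
    rw [hmap, add_sub_add_right_eq_sub, ← mul_sub, abs_mul, abs_of_pos h0, pow_succ'] at h3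
    refine le_of_mul_le_mul_left ?_ h0
    linarith

theorem half_mem_genCantorSet (h0 : 0 < l) (h1 : l < 1 / 2) :
    1 / 2 ∈ genCantorSet (1 - 2 * l) := by
  rw [mem_genCantorSet_iff]
  refine ⟨by norm_num [abs_of_pos], fun j c hc => ?_⟩
  have h2 := (abs_le.1 (abs_cantorMidpoint_le h0 h1 j c hc)).2
  refine le_trans ?_ (le_abs_self _)
  have h3 : 0 < l ^ j := by positivity
  nlinarith

theorem isSelfSimilar_genCantorSet (h0 : 0 < l) (h1 : l < 1 / 2) {s : ℝ} (hs : 0 ≤ s)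
    (hls : 2 * l ^ s = 1) :
    IsSelfSimilar l s (1 - 2 * l) (cantorShift l) (genCantorSet (1 - 2 * l)) where
  nonempty := ⟨_, half_mem_genCantorSet h0 h1⟩
  subset := fun t ht => by
    rw [mem_closedBall_zero_iff]
    exact ((mem_genCantorSet_iff t).1 ht).1
  pos := h0
  lt_one := by linarith
  dim_nonneg := hs
  card_mul := by simpa using hls
  gap_pos := by linarith
  maps := fun i x hx => genCantorSet_maps h0 h1 hx i
  cover := fun x hx => genCantorSet_cover h0 hx
  gap := fun i j hij x hx y hy => by
    rw [Real.dist_eq]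
    exact le_abs_cantorMap_sub_cantorMap h0 ((mem_genCantorSet_iff x).1 hx).1 ((mem_genCantorSet_iff y).1 hy).1 hij

/-- The point of the generalized Cantor set with a given address. -/
noncomputable def cantorPoint (l : ℝ) (a : ℕ → Fin 2) : ℝ := ∑' i, cantorShift l (a i) * l ^ i

theorem abs_cantorShift (h1 : l < 1 / 2) (i : Fin 2) :
    |cantorShift l i| = (1 - l) / 2 := by
  unfold cantorShift
  split_ifs
  · rw [abs_neg, abs_of_pos (by linarith)]
  · rw [abs_of_pos (by linarith)]

theorem norm_cantorTerm_le (h0 : 0 < l) (h1 : l < 1 / 2) (a : ℕ → Fin 2) (i : ℕ) :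
    ‖cantorShift l (a i) * l ^ i‖ ≤ (1 - l) / 2 * l ^ i := by
  rw [norm_mul, Real.norm_eq_abs, abs_cantorShift h1, Real.norm_of_nonneg (by positivity)]

theorem hasSum_cantorBound (h0 : 0 < l) (h1 : l < 1 / 2) :
    HasSum (fun i : ℕ => (1 - l) / 2 * l ^ i) (1 / 2) := by
  have := (hasSum_geometric_of_lt_one h0.le (by linarith)).mul_left ((1 - l) / 2)
  have h2 : 1 - l ≠ 0 := by linarith
  rwa [div_mul_eq_mul_div, mul_inv_cancel₀ h2] at this

theorem summable_cantorTerm (h0 : 0 < l) (h1 : l < 1 / 2) (a : ℕ → Fin 2) :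
    Summable fun i => cantorShift l (a i) * l ^ i :=
  Summable.of_norm_bounded (hasSum_cantorBound h0 h1).summable (norm_cantorTerm_le h0 h1 a)

theorem abs_cantorPoint_le (h0 : 0 < l) (h1 : l < 1 / 2) (a : ℕ → Fin 2) :
    |cantorPoint l a| ≤ 1 / 2 :=
  tsum_of_norm_bounded (hasSum_cantorBound h0 h1) (norm_cantorTerm_le h0 h1 a)

theorem cantorPoint_eq (h0 : 0 < l) (h1 : l < 1 / 2) (a : ℕ → Fin 2) :
    cantorPoint l a = l * cantorPoint l (fun i => a (i + 1)) + cantorShift l (a 0) := by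
  unfold cantorPoint
  rw [(summable_cantorTerm h0 h1 a).tsum_eq_zero_add, ← tsum_mul_left, add_comm]
  congr 1
  · exact tsum_congr fun i => by ring
  · simp

theorem cantorPoint_mem (h0 : 0 < l) (h1 : l < 1 / 2) (a : ℕ → Fin 2) :
    cantorPoint l a ∈ genCantorSet (1 - 2 * l) := by
  refine (mem_genCantorSet_iff _).2 ⟨abs_cantorPoint_le h0 h1 a, fun j => ?_⟩
  induction j generalizing a with
  | zero =>
    rw [cantorPoint_eq h0 h1]
    exact le_abs_cantorMap h0 (abs_cantorPoint_le h0 h1 _) _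
  | succ j ih =>
    rw [cantorPoint_eq h0 h1]
    exact le_abs_cantorMap_sub h0 h1 (abs_cantorPoint_le h0 h1 _) (ih _) _

theorem dimH_genCantorSet (h0 : 0 < l) (h1 : l < 1 / 2) {s : ℝ} (hs : 0 < s)
    (hls : 2 * l ^ s = 1) : dimH (genCantorSet (1 - 2 * l)) = ENNReal.ofReal s :=
  have h := isSelfSimilar_genCantorSet h0 h1 hs.le hls
  le_antisymm h.dimH_le (h.le_dimH one_lt_two hs (cantorPoint l) (cantorPoint_mem h0 h1)
    (cantorPoint_eq h0 h1))

end Cantor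

/-! ### The singular set in ℝᵏ -/

/-- The isometric embedding of the line as the last coordinate axis. -/
noncomputable def lastAxis {k : ℕ} (hk : 0 < k) : ℝ →ₗᵢ[ℝ] EuclideanSpace ℝ (Fin k) where
  toLinearMap := LinearMap.toSpanSingleton ℝ _ (EuclideanSpace.single ⟨k - 1, by omega⟩ (1 : ℝ))
  norm_map' t := by simp [norm_smul]

theorem lastAxis_apply {k : ℕ} (hk : 0 < k) (t : ℝ) (i : Fin k) :
    lastAxis hk t i = if (i : ℕ) + 1 = k then t else 0 := by
  have : lastAxis hk t = t • EuclideanSpace.single ⟨k - 1, by omega⟩ (1 : ℝ) := rfl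
  rw [this, PiLp.smul_apply, PiLp.single_apply]
  have h1 : i = ⟨k - 1, by omega⟩ ↔ (i : ℕ) + 1 = k := by
    rw [Fin.ext_iff]
    simp only
    omega
  simp [h1]

theorem singularSet_eq_image {k : ℕ} (hk : 0 < k) (lam : ℝ) :
    singularSet k lam = lastAxis hk '' genCantorSet (1 - 2 * 2 ^ (-(1 / ((k : ℝ) - lam)))) := by
  have h1 : (1 : ℝ) - 2 * 2 ^ (-(1 / ((k : ℝ) - lam))) = 1 - 2 ^ (1 - 1 / ((k : ℝ) - lam)) := by
    rw [sub_eq_add_neg (1 : ℝ) (1 / ((k : ℝ) - lam)), Real.rpow_add two_pos, Real.rpow_one]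
  rw [h1]
  ext z
  constructor
  · intro hz
    refine ⟨z ⟨k - 1, by omega⟩, (hz ⟨k - 1, by omega⟩).2 (by simp only; omega), ?_⟩
    ext i
    rw [lastAxis_apply]
    split_ifs with hi
    · have hi' : (⟨k - 1, by omega⟩ : Fin k) = i := Fin.ext (by simp only; omega)
      rw [hi']
    · exact ((hz i).1 (by omega)).symm
  · rintro ⟨t, ht, rfl⟩ i
    rw [lastAxis_apply]
    exact ⟨fun hi => if_neg (by omega), fun hi => by rwa [if_pos hi]⟩

/-- The ratio is the solution of `2 * l ^ s = 1`; dimension `s < 1` is what makes it less than 1/2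
and leaves a gap between the pieces. -/
theorem cantorRatio_props {s : ℝ} (hs : 0 < s) (hs1 : s < 1) :
    (0 : ℝ) < 2 ^ (-(1 / s)) ∧ (2 : ℝ) ^ (-(1 / s)) < 1 / 2 ∧
      2 * ((2 : ℝ) ^ (-(1 / s))) ^ s = 1 := by
  refine ⟨by positivity, ?_, ?_⟩
  · have h1 : 1 < 1 / s := (one_lt_div hs).2 hs1
    have h2 : (2 : ℝ) ^ (-(1 / s)) < 2 ^ (-1 : ℝ) :=
      Real.rpow_lt_rpow_of_exponent_lt one_lt_two (by linarith)
    rwa [Real.rpow_neg_one, ← one_div] at h2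
  · rw [← Real.rpow_mul two_pos.le, neg_mul, one_div_mul_cancel hs.ne', Real.rpow_neg_one]
    norm_num

theorem dimH_singularSet {k : ℕ} (hk : 0 < k) {lam : ℝ} (h1 : (k : ℝ) - 1 < lam) (h2 : lam < k) :
    dimH (singularSet k lam) = ENNReal.ofReal (k - lam) := by
  obtain ⟨h3, h4, h5⟩ := cantorRatio_props (s := k - lam) (by linarith) (by linarith)
  rw [singularSet_eq_image hk, (lastAxis hk).isometry.dimH_image]
  exact dimH_genCantorSet h3 h4 (by linarith) h5

theorem exists_isSelfSimilar_singularSet {k : ℕ} (hk : 0 < k) {lam : ℝ} (h1 : (k : ℝ) - 1 < lam)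
    (h2 : lam < k) : ∃ (l g : ℝ) (v : Fin 2 → EuclideanSpace ℝ (Fin k)),
      IsSelfSimilar l (k - lam) g v (singularSet k lam) := by
  obtain ⟨h3, h4, h5⟩ := cantorRatio_props (s := k - lam) (by linarith) (by linarith)
  rw [singularSet_eq_image hk]
  exact ⟨_, _, _, (isSelfSimilar_genCantorSet h3 h4 (by linarith) h5).image (lastAxis hk)⟩

/-! ### Identification of the explicit functions, and the main theorem -/

theorem counterexampleInt_eq {n k : ℕ} (h : k ≤ n) (α : ℝ) (ξ : ℝ → ℝ) :
    counterexampleInt h α ξ = truncPower h {0} 2 α 0 ξ := by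
  funext x
  unfold counterexampleInt truncPower
  rw [infDist_singleton, dist_zero_right, max_eq_left (norm_nonneg _)]

theorem distCounterexampleCutoff_eq {n k : ℕ} (h : k ≤ n) (lam α : ℝ) (ξ : ℝ → ℝ) :
    distCounterexampleCutoff h lam α ξ = truncPower h (singularSet k lam) 4 α 0 ξ := by
  funext x
  unfold distCounterexampleCutoff distCounterexample truncPower
  rw [max_eq_left infDist_nonneg]

/-- For k = n the tail has no coordinates, so its norm is 0, where every cutoff equals 1. -/
theorem distCounterexample_eq {n : ℕ} (lam α : ℝ) {ξ : ℝ → ℝ} (hξ : IsCutoff ξ) :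
    (distCounterexample lam α : EuclideanSpace ℝ (Fin n) → ℝ) =
      truncPower le_rfl (singularSet n lam) 4 α 0 ξ := by
  rw [← distCounterexampleCutoff_eq]
  funext x
  have h1 : headPart le_rfl x = x := rfl
  have h2 : tailPart le_rfl x = 0 := by
    ext i
    have := i.2
    omega
  rw [distCounterexampleCutoff, h1, h2, norm_zero, hξ.eq_one 0 le_rfl (by norm_num), mul_one]

theorem exists_isCutoff : ∃ ξ : ℝ → ℝ, IsCutoff ξ := by
  have h3 : 1 / 2 < √3 / 3 := by
    have : 3 / 2 < √3 := Real.lt_sqrt_of_sq_lt (by norm_num)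
    linarith
  set d := √3 / 3 - 1 / 2
  have hd : 0 < d := sub_pos.2 h3
  refine ⟨fun t => max (min ((√3 / 3 - t) / d) 1) 0, ?_, ?_, ?_, ?_⟩
  · refine ⟨⟨d⁻¹, by positivity⟩, LipschitzOnWith.of_dist_le_mul fun x _ y _ => ?_⟩
    rw [Real.dist_eq]
    refine (abs_max_sub_max_le_abs _ _ _).trans ((abs_min_sub_min_le_max _ _ _ _).trans ?_)
    rw [sub_self, abs_zero, max_eq_left (abs_nonneg _), ← sub_div, abs_div, abs_of_pos hd,
      sub_sub_sub_cancel_left, abs_sub_comm, Real.dist_eq, div_eq_inv_mul]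
    rfl
  · exact fun t _ => ⟨le_max_right _ _, max_le (min_le_right _ _) zero_le_one⟩
  · intro t _ ht
    have : 1 ≤ (√3 / 3 - t) / d := by
      rw [le_div_iff₀ hd]
      simp only [d]
      linarith
    simp only [min_eq_right this, max_eq_left zero_le_one]
  · intro t ht
    have : (√3 / 3 - t) / d ≤ 0 := div_nonpos_of_nonpos_of_nonneg (by linarith) hd.le
    simp only [min_eq_left (this.trans zero_le_one), max_eq_right this]

theorem norm_sq_lt_of_infDist_singleton_le {k : ℕ} (z : EuclideanSpace ℝ (Fin k))
    (hz : infDist z {0} ≤ 1 / 2) : ‖z‖ ^ 2 < 2 / 3 := by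
  rw [infDist_singleton, dist_zero_right] at hz
  nlinarith [norm_nonneg z]

theorem IsSelfSimilar.norm_sq_lt {k : ℕ} {ι : Type*} [Fintype ι] {l s g : ℝ}
    {v : ι → EuclideanSpace ℝ (Fin k)} {E : Set (EuclideanSpace ℝ (Fin k))}
    (hE : IsSelfSimilar l s g v E) (z : EuclideanSpace ℝ (Fin k))
    (hz : infDist z E ≤ 1 / 4) : ‖z‖ ^ 2 < 2 / 3 := by
  -- The slack from 1/4 to 3/10 avoids a nearest point; it still leaves ‖z‖ < 1/2 + 3/10 = 4/5, and
  -- 16/25 < 2/3.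
  obtain ⟨e, he, hd⟩ := (infDist_lt_iff hE.nonempty).1 (hz.trans_lt (by norm_num : (1 / 4 : ℝ) < 3 / 10))
  have h1 := hE.subset he
  rw [mem_closedBall_zero_iff] at h1
  rw [dist_eq_norm] at hd
  have h2 := norm_sub_norm_le z e
  have h3 : ‖z‖ < 4 / 5 := by linarith
  nlinarith [norm_nonneg z]

/-- For every `λ ∈ (0, n]` there is a self-similar set of codimension `λ` in some `ℝᵏ`, `k ≤ n`. -/
theorem exists_isSelfSimilar {n : ℕ} {lam : ℝ} (h0 : 0 < lam) (hn : lam ≤ n) :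
    ∃ (k : ℕ) (_ : k ≤ n) (ι : Type) (_ : Fintype ι) (l s g c : ℝ)
      (v : ι → EuclideanSpace ℝ (Fin k)) (E : Set (EuclideanSpace ℝ (Fin k))),
      IsSelfSimilar l s g v E ∧ lam = k - s ∧ 1 ≤ c ∧
        ∀ z, infDist z E ≤ 1 / c → ‖z‖ ^ 2 < 2 / 3 := by
  have hk : ⌈lam⌉₊ ≤ n := Nat.ceil_le.2 hn
  rcases (Nat.le_ceil lam).eq_or_lt with h | h
  · exact ⟨_, hk, Unit, inferInstance, _, _, _, 2, _, _, isSelfSimilar_singleton, by simpa using h,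
      one_le_two, norm_sq_lt_of_infDist_singleton_le⟩
  · obtain ⟨l, g, v, hE⟩ := exists_isSelfSimilar_singularSet (Nat.ceil_pos.2 h0)
      (by linarith [Nat.ceil_lt_add_one h0.le]) h
    exact ⟨_, hk, Fin 2, inferInstance, l, _, g, 4, v, _, hE, by ring, by norm_num, hE.norm_sq_lt⟩

theorem theorem1p3 (n : ℕ) (p lam q : ℝ) (hp : 1 < p) (hpl : p < lam) (hln : lam < n)
    (hq : lam * p / (lam - p) < q) :
    -- existence of a counterexample
    (∃ u : EuclideanSpace ℝ (Fin n) → ℝ, IsCounterexample p lam q u) ∧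
    -- explicit counterexamples when `λ = k` is an integer
    (∀ (k : ℕ) (hk : k < n), lam = k →
      ∀ (α : ℝ) (ξ : ℝ → ℝ), lam / q ≤ α → α < (lam - p) / p → IsCutoff ξ →
        IsCounterexample p lam q (counterexampleInt hk.le α ξ)) ∧
    -- the dimension of the singular set when `k - 1 < λ < k`
    (∀ k : ℕ, 2 ≤ k → k ≤ n → (k : ℝ) - 1 < lam → lam < k →
      dimH (singularSet k lam) = ENNReal.ofReal (k - lam)) ∧
    -- explicit counterexamples when `n - 1 < λ < n`
    ((n : ℝ) - 1 < lam →
      ∀ α : ℝ, lam / q ≤ α → α < (lam - p) / p →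
        IsCounterexample p lam q
          (distCounterexample lam α : EuclideanSpace ℝ (Fin n) → ℝ)) ∧
    -- explicit counterexamples when `k - 1 < λ < k` with `k < n`
    (∀ (k : ℕ) (hk : k < n), 2 ≤ k → (k : ℝ) - 1 < lam → lam < k →
      ∀ (α : ℝ) (ξ : ℝ → ℝ), lam / q ≤ α → α < (lam - p) / p → IsCutoff ξ →
        IsCounterexample p lam q (distCounterexampleCutoff hk.le lam α ξ)) ∧
    -- the embeddings fail for the exponent `q`, already on Lipschitz functions
    (¬ ∃ C : ℝ≥0, ∀ u : EuclideanSpace ℝ (Fin n) → ℝ, (∃ K : ℝ≥0, LipschitzWith K u) →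
      (∀ x ∉ ball (0 : EuclideanSpace ℝ (Fin n)) 1, u x = 0) →
      eLpNorm u (ENNReal.ofReal q) (volume.restrict (ball 0 1)) ≤
        C * morreyNorm p lam (ball 0 1) (gradient u)) ∧
    (¬ ∃ C : ℝ≥0, ∀ u : EuclideanSpace ℝ (Fin n) → ℝ, (∃ K : ℝ≥0, LipschitzWith K u) →
      (∀ x ∉ ball (0 : EuclideanSpace ℝ (Fin n)) 1, u x = 0) →
      eLpNorm u (ENNReal.ofReal q) (volume.restrict (ball 0 1)) ≤
        C * tripleNorm p lam (ball 0 1) (gradient u)) := by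

  have hp0 : 0 < p := by linarith
  have hlp : 0 < lam - p := by linarith
  have hlam : 0 < lam := by linarith
  have hq0 : 0 < q := lt_trans (by positivity) hq
  have hparam : ∀ α : ℝ, lam / q ≤ α → α < (lam - p) / p →
      0 < α ∧ (α + 1) * p < lam ∧ lam ≤ α * q := by
    intro α h1 h2
    refine ⟨lt_of_lt_of_le (by positivity) h1, ?_, (div_le_iff₀ hq0).1 h1⟩
    rw [lt_div_iff₀ hp0] at h2
    linarith
  -- The hypothesis q > p₁ rearranged: the range of admissible α is nonempty and λ/q belongs to it.
  have hα0 : lam / q < (lam - p) / p := by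
    rw [div_lt_iff₀ hlp] at hq
    rw [div_lt_div_iff₀ hq0 hp0]
    linarith
  obtain ⟨ξ₀, hξ₀⟩ := exists_isCutoff
  have hmain : ∀ {k : ℕ} (h : k ≤ n) {ι : Type} [Fintype ι] {l s g c : ℝ}
      {v : ι → EuclideanSpace ℝ (Fin k)} {E : Set (EuclideanSpace ℝ (Fin k))},
      IsSelfSimilar l s g v E → lam = k - s → 1 ≤ c →
        (∀ z, infDist z E ≤ 1 / c → ‖z‖ ^ 2 < 2 / 3) →
      ∀ (α : ℝ) (ξ : ℝ → ℝ), lam / q ≤ α → α < (lam - p) / p → IsCutoff ξ →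
        IsCounterexample p lam q (truncPower h E c α 0 ξ) := by
    intro k h ι _ l s g c v E hE hs hc hEc α ξ h1 h2 hξ
    obtain ⟨h3, h4, h5⟩ := hparam α h1 h2
    subst hs
    exact hE.isCounterexample h hp hq0 h3 h4 h5 hξ hc hEc
  have hcantor : ∀ (k : ℕ) (hk : k ≤ n), (k : ℝ) - 1 < lam → lam < k →
      ∀ (α : ℝ) (ξ : ℝ → ℝ), lam / q ≤ α → α < (lam - p) / p → IsCutoff ξ →
        IsCounterexample p lam q (truncPower hk (singularSet k lam) 4 α 0 ξ) := by
    intro k hk h1 h2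
    have hk0 : 0 < k := by exact_mod_cast hlam.trans h2
    obtain ⟨l, g, v, hE⟩ := exists_isSelfSimilar_singularSet hk0 h1 h2
    exact hmain hk hE (by ring) (by norm_num) hE.norm_sq_lt
  obtain ⟨k, hk, ι, _, l, s, g, c, v, E, hE, hs, hc, hEc⟩ := exists_isSelfSimilar hlam hln.le
  obtain ⟨h3, h4, h5⟩ := hparam _ le_rfl hα0
  have hlip : ∀ C : ℝ≥0, ∃ u : EuclideanSpace ℝ (Fin n) → ℝ, (∃ K : ℝ≥0, LipschitzWith K u) ∧
      (∀ x ∉ ball (0 : EuclideanSpace ℝ (Fin n)) 1, u x = 0) ∧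
      C * tripleNorm p lam (ball 0 1) (gradient u) <
        eLpNorm u (ENNReal.ofReal q) (volume.restrict (ball 0 1)) := by
    intro C
    subst hs
    exact hE.exists_lipschitzWith_lt_eLpNorm hk hp hq0 h3 h4 h5 hξ₀ hc hEc C
  refine ⟨⟨_, hmain hk hE hs hc hEc _ ξ₀ le_rfl hα0 hξ₀⟩, ?_, ?_, ?_, ?_, ?_, ?_⟩
  · intro k hk hlk α ξ h1 h2 hξ
    rw [counterexampleInt_eq]
    exact hmain hk.le isSelfSimilar_singleton (by simpa using hlk) one_le_two
      norm_sq_lt_of_infDist_singleton_le α ξ h1 h2 hξ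
  · intro k hk2 _ h1 h2
    exact dimH_singularSet (by omega) h1 h2
  · intro h1 α h2 h3
    rw [distCounterexample_eq lam α hξ₀]
    exact hcantor n le_rfl h1 hln α ξ₀ h2 h3 hξ₀
  · intro k hk _ h1 h2 α ξ h3 h4 hξ
    rw [distCounterexampleCutoff_eq]
    exact hcantor k hk.le h1 h2 α ξ h3 h4 hξ
  · rintro ⟨C, hC⟩
    obtain ⟨u, hu1, hu2, hu3⟩ := hlip C
    refine (hu3.trans_le (hC u hu1 hu2)).not_ge ?_
    exact mul_le_mul_right (morreyNorm_le_tripleNorm hp0.le hln.le measurableSet_ball _) _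
  · rintro ⟨C, hC⟩
    obtain ⟨u, hu1, hu2, hu3⟩ := hlip C
    exact (hu3.trans_le (hC u hu1 hu2)).false
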